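/- Let $G$ be a finite-dimensional real Lie group with unit $e$, Lie algebra $\mathfrak g$ and exponential map $\exp$. Let $\mathfrak D\colon G\to G$ be a difference operator, i.e. a smooth map with $\mathfrak D(gh)=\mathfrak D(g)\,g\,\mathfrak D(h)\,g^{-1}$ for all $g,h\in G$. Let $V$ be a finite-dimensional real vector space, $T\colon V\to V$ a linear map and $\Theta\colon G\to GL(V)$ a Lie group homomorphism with $$T(\Theta(g)u)+\Theta(g)u=\Theta(\mathfrak D(g)g)T(u)+\Theta(\mathfrak D(g)g)u\qquad(g\in G,\ u\in V).$$ Put $\Theta_{\mathfrak D}(g)=\Theta(\mathfrak D(g)g)$, $D=\mathfrak D_{*e}\colon\mathfrak g\to\mathfrak g$, $\theta=\Theta_{*e}\colon\mathfrak g\to\mathfrak{gl}(V)$ and $\theta_D(x)=\theta(x)+\theta(D(x))$. *Group side.* Let $C^n(G,V)$ be the space of smooth maps $\alpha\colon G^n\to V$ that vanish whenever some argument equals $e$, and let $d^\Theta\colon C^n(G,V)\to C^{n+1}(G,V)$, $$d^\Theta\alpha(g_1,\dots,g_{n+1})=\Theta(g_1)\alpha(g_2,\dots,g_{n+1})+\sum_{i=1}^n(-1)^i\alpha(g_1,\dots,g_ig_{i+1},\dots,g_{n+1})+(-1)^{n+1}\alpha(g_1,\dots,g_n);$$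 $d^{\Theta_{\mathfrak D}}$ is defined likewise from $\Theta_{\mathfrak D}$. Define $\mathfrak K\colon C^n(G,V)\to C^n(G,V)$, $n\ge1$, by $\mathfrak K(\alpha)=p(\alpha)+h(\alpha)$ with $$h(\alpha)(g_1,\dots,g_n)=(-1)^n\big(\alpha(\mathfrak D(g_1)g_1,\dots,\mathfrak D(g_n)g_n)-T(\alpha(g_1,\dots,g_n))-\alpha(g_1,\dots,g_n)\big),$$ $p(\alpha)(g_1)=-\Theta(\mathfrak D(g_1))\alpha(g_1)+\alpha(\mathfrak D(g_1)g_1)-\alpha(\mathfrak D(g_1))$ for $n=1$, $p(\alpha)(g_1,g_2)=\alpha(\mathfrak D(g_1),g_1)-\alpha(\mathfrak D(g_1g_2),g_1g_2)+\Theta(\mathfrak D(g_1)g_1)\alpha(\mathfrak D(g_2),g_2)$ for $n=2$, and $p(\alpha)=0$ for $n\ge3$. Let $C^1(G,\mathfrak D,V,T)=C^1(G,V)$ and $C^n(G,\mathfrak D,V,T)=C^n(G,V)\oplus C^{n-1}(G,V)$ for $n\ge2$, with coboundary operator $\delta(\alpha_n,\beta_{n-1})=(d^\Theta\alpha_n,\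 d^{\Theta_{\mathfrak D}}\beta_{n-1}+\mathfrak K(\alpha_n))$ (where $\beta_0=0$ and $d^{\Theta_{\mathfrak D}}\beta_0=0$). Its cohomology in degree $n\ge1$ (cocycles modulo coboundaries; there are no non-zero coboundaries in degree $1$) is denoted $\mathcal H^n(G,\mathfrak D,V,T)$. *Lie algebra side.* Let $C^n(\mathfrak g,V)=\operatorname{Hom}(\wedge^n\mathfrak g,V)$, let $d^\theta,d^{\theta_D}$ be the Chevalley–Eilenberg coboundary operators with coefficients in $(V,\theta)$ and $(V,\theta_D)$, and let $K\colon C^n(\mathfrak g,V)\to C^n(\mathfrak g,V)$, $$K(\zeta)(x_1,\dots,x_n)=(-1)^n\Big(\sum_{\emptyset\ne S\subseteq\{1,\dots,n\}}\zeta(x_1^S,\dots,x_n^S)-T(\zeta(x_1,\dots,x_n))\Big),$$ where $x_i^S=D(x_i)$ for $i\in S$ and $x_i^S=x_i$ for $i\notin S$. Let $C^1(\mathfrak g,D,V,T)=C^1(\mathfrak g,V)$ and $C^n(\mathfrak g,D,V,T)=C^n(\mathfrak g,V)\oplus C^{n-1}(\mathfrak g,V)$ for $n\ge2$, with $\delta_\theta(\zeta_n,\xi_{n-1})=(d^\theta\zeta_n,\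 d^{\theta_D}\xi_{n-1}+K(\zeta_n))$ (where $\xi_0=0$ and $d^{\theta_D}\xi_0=0$), and cohomology $H^n(\mathfrak g,D,V,T)$, $n\ge1$. *Theorem.* The formula $$\mathrm{VE}_n(\alpha)(x_1,\dots,x_n)=\sum_{\epsilon\in S_n}(-1)^{|\epsilon|}\frac{d}{dt_{\epsilon(1)}}\cdots\frac{d}{dt_{\epsilon(n)}}\bigg|_{t_1=\cdots=t_n=0}\alpha\big(\exp(t_{\epsilon(1)}x_{\epsilon(1)}),\dots,\exp(t_{\epsilon(n)}x_{\epsilon(n)})\big)$$ defines linear maps $\mathrm{VE}_n\colon C^n(G,V)\to C^n(\mathfrak g,V)$, which satisfy $\mathrm{VE}_n\circ\mathfrak K=K\circ\mathrm{VE}_n$ for all $n\ge1$. The maps $$\widetilde{\mathrm{VE}}_n\colon C^n(G,\mathfrak D,V,T)\to C^n(\mathfrak g,D,V,T),\qquad \widetilde{\mathrm{VE}}_n(\alpha_n,\beta_{n-1})=(\mathrm{VE}_n\alpha_n,\mathrm{VE}_{n-1}\beta_{n-1}),\quad n\ge1$$ (with $\mathrm{VE}_0\beta_0=0$), form a cochain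 map: $\widetilde{\mathrm{VE}}_{n+1}\circ\delta=\delta_\theta\circ\widetilde{\mathrm{VE}}_n$ for all $n\ge1$. Consequently, for every $n\ge1$ there is a well-defined homomorphism $\widetilde{\mathrm{VE}}_{n*}\colon\mathcal H^n(G,\mathfrak D,V,T)\to H^n(\mathfrak g,D,V,T)$, $[z]\mapsto[\widetilde{\mathrm{VE}}_n z]$. -/

import Mathlib

open scoped Manifold ContDiff
open Set Filter Topology

namespace DiffLie
noncomputable section

section Power
variable {E H G E' H' M : Type*} [NormedAddCommGroup E] [NormedSpace ℝ E] [TopologicalSpace H]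
  [TopologicalSpace G] [ChartedSpace H G] [NormedAddCommGroup E'] [NormedSpace ℝ E']
  [TopologicalSpace H'] [TopologicalSpace M] [ChartedSpace H' M]

/-- The model of the product manifold `Gⁿ`. -/
abbrev powModel (I : ModelWithCorners ℝ E H) (n : ℕ) :
    ModelWithCorners ℝ (Fin n → E) (ModelPi fun _ : Fin n => H) :=
  ModelWithCorners.pi fun _ : Fin n => I

lemma contMDiff_power (I : ModelWithCorners ℝ E H) (J : ModelWithCorners ℝ E' H') {n : ℕ}
    {f : M → Fin n → G} (hf : ∀ i, ContMDiff J I ∞ fun x => f x i) :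
    ContMDiff J (powModel I n) ∞ f := by
  intro x
  rw [contMDiffAt_iff]
  refine ⟨continuousAt_pi.2 fun i => (hf i x).continuousAt, ?_⟩
  rw [contDiffWithinAt_pi]
  intro i
  exact (contMDiffAt_iff.1 (hf i x)).2

lemma contMDiff_power_apply (I : ModelWithCorners ℝ E H) {n : ℕ} (i : Fin n) :
    ContMDiff (powModel I n) I ∞ fun g : Fin n → G => g i := by
  intro x
  rw [contMDiffAt_iff]
  refine ⟨(continuous_apply i).continuousAt, ?_⟩
  have h : ContDiffWithinAt ℝ ∞ (fun y : Fin n → E => y i) (range (powModel I n))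
      (extChartAt (powModel I n) x x) := (contDiff_apply ℝ E i).contDiffWithinAt
  refine h.congr_of_eventuallyEq_of_mem ?_ ?_
  · have hs : (extChartAt (powModel I n) x).target ∈
        𝓝[range (powModel I n)] (extChartAt (powModel I n) x x) := extChartAt_target_mem_nhdsWithin x
    filter_upwards [hs] with y hy
    have hyi : y i ∈ (extChartAt I (x i)).target := ⟨hy.1 i trivial, hy.2 i trivial⟩
    exact (extChartAt I (x i)).right_inv hyi
  · exact mem_range_self _

lemma contMDiff_constSmul {V : Type*} [NormedAddCommGroup V] [NormedSpace ℝ V]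
    {J : ModelWithCorners ℝ E' H'} (c : ℝ) {f : M → V} (hf : ContMDiff J 𝓘(ℝ, V) ∞ f) :
    ContMDiff J 𝓘(ℝ, V) ∞ fun x => c • f x :=
  (contDiff_const_smul (𝕜 := ℝ) (F := V) (n := ∞) c).contMDiff.comp hf

end Power

section Exp
variable {d : ℕ} {G : Type*} [TopologicalSpace G] [ChartedSpace (EuclideanSpace ℝ (Fin d)) G]
  [Group G] [LieGroup (𝓡 d) ∞ G]

instance instLieGroupMinSmoothness : LieGroup (𝓡 d) (minSmoothness ℝ 3) G := by
  rw [minSmoothness_of_isRCLikeNormedField]; infer_instance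

lemma mdiff_mul_left (g : G) : MDifferentiable (𝓡 d) (𝓡 d) (g * ·) :=
  (contMDiff_mul_left (I := 𝓡 d) (n := ∞)).mdifferentiable (by simp)

lemma mfderiv_mulInvariant (x : GroupLieAlgebra (𝓡 d) G) (g h : G) :
    mfderiv (𝓡 d) (𝓡 d) (g * ·) h (mulInvariantVectorField x h) = mulInvariantVectorField x (g * h) := by
  have e : (fun b : G => g * h * b) = (g * ·) ∘ (h * ·) := by ext; simp [mul_assoc]
  simp only [mulInvariantVectorField]
  rw [e, mfderiv_comp (I' := 𝓡 d) (1 : G) (mdiff_mul_left g _) (mdiff_mul_left h _)]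
  have key : ∀ (k : G) (v : EuclideanSpace ℝ (Fin d)), k = h →
      (mfderiv (𝓡 d) (𝓡 d) (g * ·) h v : EuclideanSpace ℝ (Fin d)) =
        mfderiv (𝓡 d) (𝓡 d) (g * ·) k v := by
    rintro k v rfl; rfl
  exact key (h * 1) _ (mul_one h)

theorem exists_expCurve [T2Space G] (x : GroupLieAlgebra (𝓡 d) G) :
    ∃ γ : ℝ → G, γ 0 = 1 ∧ IsMIntegralCurve γ (mulInvariantVectorField (I := 𝓡 d) x) := by
  have hv : ContMDiff (𝓡 d) (𝓡 d).tangent 1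
      (fun g : G => (⟨g, mulInvariantVectorField x g⟩ : TangentBundle (𝓡 d) G)) :=
    (contMDiff_mulInvariantVectorField x).of_le
      (by rw [minSmoothness_of_isRCLikeNormedField]; exact one_le_two)
  obtain ⟨γ, h0, hγ⟩ := exists_isMIntegralCurveAt_of_contMDiffAt_boundaryless (t₀ := 0) (hv 1)
  rw [isMIntegralCurveAt_iff'] at hγ
  obtain ⟨ε, hε, hγ⟩ := hγ
  refine exists_isMIntegralCurve_of_isMIntegralCurveOn hv hε (fun g => ⟨fun t => g * γ t, by simp [h0], ?_⟩) 1
  intro t ht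
  have h1 := hγ t (by simpa [Real.ball_eq_Ioo] using ht)
  have h2 := ((mdiff_mul_left (d := d) g (γ t)).hasMFDerivAt).comp_hasMFDerivWithinAt t h1
  simp only [Real.ball_eq_Ioo, zero_sub, zero_add] at h2
  have e : (ContinuousLinearMap.smulRight (1 : ℝ →L[ℝ] ℝ)
      (mulInvariantVectorField x (g * γ t)) : ℝ →L[ℝ] EuclideanSpace ℝ (Fin d)) =
      (mfderiv (𝓡 d) (𝓡 d) (g * ·) (γ t)) ∘L
        ContinuousLinearMap.smulRight (1 : ℝ →L[ℝ] ℝ) (mulInvariantVectorField x (γ t)) := by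
    have key : ∀ (A : EuclideanSpace ℝ (Fin d) →L[ℝ] EuclideanSpace ℝ (Fin d))
        (v : EuclideanSpace ℝ (Fin d)), ContinuousLinearMap.smulRight (1 : ℝ →L[ℝ] ℝ) (A v) =
          A ∘L ContinuousLinearMap.smulRight (1 : ℝ →L[ℝ] ℝ) v := by
      intro A v; ext1; simp
    rw [← mfderiv_mulInvariant]
    exact key _ _
  change HasMFDerivWithinAt _ _ _ _ _ (ContinuousLinearMap.smulRight (1 : ℝ →L[ℝ] ℝ)
      (mulInvariantVectorField x (g * γ t)) : ℝ →L[ℝ] EuclideanSpace ℝ (Fin d))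
  rw [e]
  exact h2

/-- The Lie group exponential: the value at time `1` of the integral curve through the identity
of the left-invariant vector field generated by `x`. -/
def lieExp [T2Space G] (x : GroupLieAlgebra (𝓡 d) G) : G := (exists_expCurve x).choose 1
end Exp

section Groups
variable (d : ℕ) (G : Type*) [TopologicalSpace G] [ChartedSpace (EuclideanSpace ℝ (Fin d)) G]
  [Group G] (V : Type*) [NormedAddCommGroup V] [NormedSpace ℝ V]

/-- A difference operator on the Lie group `G`. -/
structure DifferenceOperator where
  toFun : G → G
  smooth : ContMDiff (𝓡 d) (𝓡 d) ∞ toFun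
  map_mul : ∀ g h, toFun (g * h) = toFun g * g * toFun h * g⁻¹

instance : CoeFun (DifferenceOperator d G) fun _ => G → G := ⟨DifferenceOperator.toFun⟩

/-- A Lie group homomorphism `G → GL(V)`; since `GL(V)` is open in `End(V)`, smoothness is tested
in the normed space `End(V)`. -/
structure SmoothRep where
  hom : G →* (V →L[ℝ] V)ˣ
  smooth : ContMDiff (𝓡 d) 𝓘(ℝ, V →L[ℝ] V) ∞ fun g => (hom g : V →L[ℝ] V)

instance : CoeFun (SmoothRep d G V) fun _ => G → V →L[ℝ] V := ⟨fun Θ g => (Θ.hom g : V →L[ℝ] V)⟩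

variable {d G}

/-- A representation `(V, T, Θ)` of the difference Lie group `(G, D)`. -/
structure DifferenceRep (D : DifferenceOperator d G) where
  T : V →ₗ[ℝ] V
  Θ : SmoothRep d G V
  compat : ∀ g u, T (Θ g u) + Θ g u = Θ (D g * g) (T u) + Θ (D g * g) u

lemma DifferenceOperator.map_one (D : DifferenceOperator d G) : D 1 = 1 := by
  have h := D.map_mul 1 1
  simpa using h

variable {V}

/-- The representation `Θ_D(g) = Θ(D(g) g)`. -/
def SmoothRep.twist [LieGroup (𝓡 d) ∞ G] (Θ : SmoothRep d G V) (D : DifferenceOperator d G) :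
    SmoothRep d G V where
  hom :=
    { toFun := fun g => Θ.hom (D g * g)
      map_one' := by simp [D.map_one]
      map_mul' := fun g h => by rw [D.map_mul, ← _root_.map_mul]; congr 1; group }
  smooth := Θ.smooth.comp (D.smooth.mul contMDiff_id)

variable (d G V)

/-- Normalized smooth `n`-cochains on the Lie group `G` with values in `V`. -/
def GroupCochain (n : ℕ) : Submodule ℝ ((Fin n → G) → V) where
  carrier := {α | ContMDiff (powModel (𝓡 d) n) 𝓘(ℝ, V) ∞ α ∧ ∀ g, (∃ i, g i = 1) → α g = 0}
  add_mem' ha hb := ⟨ha.1.add hb.1, fun g hg => by simp [ha.2 g hg, hb.2 g hg]⟩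
  zero_mem' := ⟨contMDiff_const, fun _ _ => rfl⟩
  smul_mem' c _ ha := ⟨contMDiff_constSmul c ha.1, fun g hg => by simp [ha.2 g hg]⟩

variable {d G V}

/-- The group coboundary. With indices counted from `0`, `Fin.contractNth i (· * ·) g` is
`(g₀, …, gᵢ gᵢ₊₁, …, gₙ)`. -/
def groupCobFun (Θ : SmoothRep d G V) {n : ℕ} (α : (Fin n → G) → V) (g : Fin (n + 1) → G) : V :=
  Θ (g 0) (α fun i => g i.succ)
    + ∑ i : Fin n, (-1 : ℝ) ^ (i.val + 1) • α (Fin.contractNth i.castSucc (· * ·) g)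
    + (-1 : ℝ) ^ (n + 1) • α fun i => g i.castSucc

lemma groupCobFun_eq (Θ : SmoothRep d G V) {n : ℕ} (α : (Fin n → G) → V) (g : Fin (n + 1) → G) :
    groupCobFun Θ α g = Θ (g 0) (α fun i => g i.succ)
      + ∑ i : Fin (n + 1), (-1 : ℝ) ^ (i.val + 1) • α (Fin.contractNth i (· * ·) g) := by
  have h : Fin.contractNth (Fin.last n) (· * ·) g = fun i => g i.castSucc := by
    ext k
    exact Fin.contractNth_apply_of_lt _ _ _ _ k.2
  rw [Fin.sum_univ_castSucc, h, groupCobFun, ← add_assoc]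
  rfl

lemma contMDiff_contractNth [LieGroup (𝓡 d) ∞ G] {n : ℕ} (j : Fin (n + 1)) :
    ContMDiff (powModel (𝓡 d) (n + 1)) (powModel (𝓡 d) n) ∞
      fun g : Fin (n + 1) → G => Fin.contractNth j (· * ·) g := by
  refine contMDiff_power _ _ fun k => ?_
  unfold Fin.contractNth
  split_ifs
  · exact contMDiff_power_apply _ _
  · exact (contMDiff_power_apply _ _).mul (contMDiff_power_apply _ _)
  · exact contMDiff_power_apply _ _

lemma groupCobFun_normalized (Θ : SmoothRep d G V) {n : ℕ} {α : (Fin n → G) → V}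
    (hα : ∀ g, (∃ i, g i = 1) → α g = 0) (g : Fin (n + 1) → G) (i : Fin (n + 1)) (hi : g i = 1) :
    groupCobFun Θ α g = 0 := by
  have e1 : ∀ j : Fin (n + 1), j.val ≠ i.val → j.val + 1 ≠ i.val →
      α (Fin.contractNth j (· * ·) g) = 0 := by
    intro j h1 h2
    refine hα _ ?_
    rcases lt_or_gt_of_ne h1 with h | h
    · refine ⟨⟨i.val - 1, by omega⟩, ?_⟩
      rw [Fin.contractNth_apply_of_gt _ _ _ _ (by simp only; omega), ← hi]
      congr 1; ext; simp only [Fin.succ_mk]; omega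
    · refine ⟨⟨i.val, by omega⟩, ?_⟩
      rw [Fin.contractNth_apply_of_lt _ _ _ _ (by simpa using h), ← hi]
      rfl
  have e2 : Fin.contractNth i (· * ·) g = fun k => g (i.succAbove k) := by
    ext k
    by_cases h : (i : ℕ) = k
    · rw [Fin.contractNth_apply_of_eq _ _ _ _ h.symm]
      have : k.castSucc = i := by ext; simp [h]
      rw [this, hi, one_mul, Fin.succAbove_of_le_castSucc _ _ this.symm.le]
    · exact Fin.contractNth_apply_of_ne _ _ _ _ h
  rw [groupCobFun_eq]
  rcases Fin.eq_zero_or_eq_succ i with rfl | ⟨j, rfl⟩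
  · rw [Finset.sum_eq_single 0 (fun j _ hj => by
      rw [e1 j (fun h => hj (Fin.ext h)) (Nat.succ_ne_zero _), smul_zero]) (by simp), e2, hi]
    simp
  · have e3 : Fin.contractNth j.castSucc (· * ·) g = fun k => g (j.succ.succAbove k) := by
      ext k
      rcases lt_trichotomy (k : ℕ) j with h | h | h
      · rw [Fin.contractNth_apply_of_lt _ _ _ _ h, Fin.succAbove_of_castSucc_lt]
        simp [Fin.lt_def]; omega
      · have hk : k = j := Fin.ext h
        rw [Fin.contractNth_apply_of_eq _ _ _ _ h, hk, hi, mul_one, Fin.succAbove_of_castSucc_lt]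
        simp [Fin.lt_def]
      · rw [Fin.contractNth_apply_of_gt _ _ _ _ h, Fin.succAbove_of_le_castSucc]
        simp [Fin.le_def]; omega
    have e0 : α (fun k => g k.succ) = 0 := hα _ ⟨j, hi⟩
    rw [e0, map_zero, zero_add, ← Finset.sum_subset (Finset.subset_univ {j.castSucc, j.succ})]
    · rw [Finset.sum_pair (by simp [Fin.ext_iff]), e2, e3]
      simp [pow_succ]
    · intro l _ hl
      simp only [Finset.mem_insert, Finset.mem_singleton, not_or, Fin.ext_iff, Fin.val_castSucc,
        Fin.val_succ] at hl
      rw [e1 l (by simpa using hl.2) (by simp; omega), smul_zero]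

/-- The coboundary operator of normalized smooth cochains with coefficients in `Θ`. -/
def groupCob [LieGroup (𝓡 d) ∞ G] (Θ : SmoothRep d G V) (n : ℕ) :
    GroupCochain d G V n →ₗ[ℝ] GroupCochain d G V (n + 1) where
  toFun α := ⟨groupCobFun Θ α.1, by
    refine ⟨?_, fun g ⟨i, hi⟩ => groupCobFun_normalized Θ α.2.2 g i hi⟩
    refine ContMDiff.add (ContMDiff.add ?_ ?_) ?_
    · exact (Θ.smooth.comp (contMDiff_power_apply _ 0)).clm_apply (α.2.1.comp
        (contMDiff_power _ _ fun i => contMDiff_power_apply _ _))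
    · exact contMDiff_finsetSum fun i _ =>
        contMDiff_constSmul _ (α.2.1.comp (contMDiff_contractNth _))
    · exact contMDiff_constSmul _
        (α.2.1.comp (contMDiff_power _ _ fun i => contMDiff_power_apply _ _))⟩
  map_add' α β := by
    ext g
    simp only [groupCobFun, Submodule.coe_add, Pi.add_apply, map_add, smul_add,
      Finset.sum_add_distrib]
    abel
  map_smul' c α := by
    ext g
    simp only [groupCobFun, SetLike.val_smul, Pi.smul_apply, map_smul, smul_add,
      RingHom.id_apply, Finset.smul_sum, smul_comm c]

/-- The first part of `𝔎`; in degree `0`, which the complex does not use, it is set to `0`. -/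
def pKFun {D : DifferenceOperator d G} (ρ : DifferenceRep V D) :
    (n : ℕ) → ((Fin n → G) → V) → (Fin n → G) → V
  | 1, α, g => -(ρ.Θ (D (g 0)) (α ![g 0])) + α ![D (g 0) * g 0] - α ![D (g 0)]
  | 2, α, g => α ![D (g 0), g 0] - α ![D (g 0 * g 1), g 0 * g 1]
      + ρ.Θ (D (g 0) * g 0) (α ![D (g 1), g 1])
  | _, _, _ => 0

/-- The second part of `𝔎`. -/
def hKFun {D : DifferenceOperator d G} (ρ : DifferenceRep V D) (n : ℕ)
    (α : (Fin n → G) → V) (g : Fin n → G) : V :=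
  (-1 : ℝ) ^ n • (α (fun i => D (g i) * g i) - ρ.T (α g) - α g)

lemma pKFun_add {D : DifferenceOperator d G} (ρ : DifferenceRep V D) (n : ℕ)
    (α β : (Fin n → G) → V) : pKFun ρ n (α + β) = pKFun ρ n α + pKFun ρ n β := by
  ext g
  match n with
  | 0 => simp [pKFun]
  | 1 => simp [pKFun]; abel
  | 2 => simp [pKFun]; abel
  | n + 3 => simp [pKFun]

lemma pKFun_smul {D : DifferenceOperator d G} (ρ : DifferenceRep V D) (n : ℕ) (c : ℝ)
    (α : (Fin n → G) → V) : pKFun ρ n (c • α) = c • pKFun ρ n α := by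
  ext g
  match n with
  | 0 => simp [pKFun]
  | 1 => simp [pKFun, smul_add, smul_sub]
  | 2 => simp [pKFun, smul_add, smul_sub]
  | n + 3 => simp [pKFun]

lemma pKFun_mem [LieGroup (𝓡 d) ∞ G] {D : DifferenceOperator d G} (ρ : DifferenceRep V D) (n : ℕ)
    {α : (Fin n → G) → V} (hα : α ∈ GroupCochain d G V n) : pKFun ρ n α ∈ GroupCochain d G V n := by
  have h1 := D.map_one
  match n with
  | 0 => exact zero_mem _
  | 1 =>
    have p0 := contMDiff_power_apply (G := G) (𝓡 d) (0 : Fin 1)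
    have q0 := D.smooth.comp p0
    refine ⟨ContMDiff.sub (ContMDiff.add (ContMDiff.neg ?_) ?_) ?_, ?_⟩
    · refine (ρ.Θ.smooth.comp q0).clm_apply (hα.1.comp (contMDiff_power _ _ fun i => ?_))
      fin_cases i; exact p0
    · refine hα.1.comp (contMDiff_power _ _ fun i => ?_)
      fin_cases i; exact q0.mul p0
    · refine hα.1.comp (contMDiff_power _ _ fun i => ?_)
      fin_cases i; exact q0
    · rintro g ⟨i, hi⟩
      have hg : g 0 = 1 := by rwa [Subsingleton.elim i 0] at hi
      have : α ![1] = 0 := hα.2 _ ⟨0, rfl⟩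
      simp [pKFun, hg, h1, this]
  | 2 =>
    have p0 := contMDiff_power_apply (G := G) (𝓡 d) (0 : Fin 2)
    have p1 := contMDiff_power_apply (G := G) (𝓡 d) (1 : Fin 2)
    have q0 := D.smooth.comp p0
    have q1 := D.smooth.comp p1
    refine ⟨ContMDiff.add (ContMDiff.sub ?_ ?_) ?_, ?_⟩
    · refine hα.1.comp (contMDiff_power _ _ fun i => ?_)
      fin_cases i
      exacts [q0, p0]
    · refine hα.1.comp (contMDiff_power _ _ fun i => ?_)
      fin_cases i
      exacts [D.smooth.comp (p0.mul p1), p0.mul p1]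
    · refine (ρ.Θ.smooth.comp (q0.mul p0)).clm_apply
        (hα.1.comp (contMDiff_power _ _ fun i => ?_))
      fin_cases i
      exacts [q1, p1]
    · rintro g ⟨i, hi⟩
      have : α ![1, 1] = 0 := hα.2 _ ⟨0, rfl⟩
      fin_cases i
      · have hg : g 0 = 1 := hi
        simp [pKFun, hg, h1, this]
      · have hg : g 1 = 1 := hi
        simp [pKFun, hg, h1, this]
  | n + 3 => exact zero_mem _

lemma hKFun_mem [LieGroup (𝓡 d) ∞ G] [FiniteDimensional ℝ V] {D : DifferenceOperator d G}
    (ρ : DifferenceRep V D) (n : ℕ)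
    {α : (Fin n → G) → V} (hα : α ∈ GroupCochain d G V n) : hKFun ρ n α ∈ GroupCochain d G V n := by
  refine ⟨contMDiff_constSmul _ (ContMDiff.sub (ContMDiff.sub ?_ ?_) hα.1), ?_⟩
  · exact hα.1.comp (contMDiff_power _ _ fun i =>
      (D.smooth.comp (contMDiff_power_apply _ i)).mul (contMDiff_power_apply _ i))
  · exact (LinearMap.toContinuousLinearMap ρ.T).contMDiff.comp hα.1
  · rintro g ⟨i, hi⟩
    have h2 : α (fun i => D (g i) * g i) = 0 := hα.2 _ ⟨i, by simp [hi, D.map_one]⟩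
    simp [hKFun, hα.2 g ⟨i, hi⟩, h2]

/-- The operator `𝔎` from `n`-cochains on `G` to `(n + 1)`-cochains of the difference operator,
which are `n`-cochains on `G`. -/
def groupK [LieGroup (𝓡 d) ∞ G] [FiniteDimensional ℝ V] {D : DifferenceOperator d G}
    (ρ : DifferenceRep V D) (n : ℕ) : GroupCochain d G V n →ₗ[ℝ] GroupCochain d G V n where
  toFun α := ⟨pKFun ρ n α.1 + hKFun ρ n α.1, add_mem (pKFun_mem ρ n α.2) (hKFun_mem ρ n α.2)⟩
  map_add' α β := by
    ext g
    simp only [Submodule.coe_add, pKFun_add, Pi.add_apply, hKFun, map_add, smul_sub, smul_add]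
    abel
  map_smul' c α := by
    ext g
    simp only [SetLike.val_smul, pKFun_smul, Pi.add_apply, Pi.smul_apply, hKFun, map_smul,
      RingHom.id_apply, smul_add, smul_sub, smul_comm c]
end Groups

section LieAlgebras
variable {L V : Type*} [LieRing L] [LieAlgebra ℝ L] [AddCommGroup V] [Module ℝ V]

/-- The Chevalley–Eilenberg coboundary of `ζ ∈ Hom(⋀ⁿ L, V)`, `n = m + 1`, with coefficients in
`θ`. The second sum runs over the pairs `i.castSucc < j.succ` of indices in `Fin (m + 2)`, that is,
over `i ≤ j` in `Fin (m + 1)`; the last argument is `x` with these two entries removed. -/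
def ceCobFun (θ : L →ₗ[ℝ] V →ₗ[ℝ] V) {m : ℕ} (ζ : L [⋀^Fin (m + 1)]→ₗ[ℝ] V)
    (x : Fin (m + 2) → L) : V :=
  ∑ i : Fin (m + 2), (-1 : ℤ) ^ i.val • θ (x i) (ζ (i.removeNth x))
    + ∑ i : Fin (m + 1), ∑ j ≥ i, (-1 : ℤ) ^ (i.castSucc.val + j.succ.val) •
        ζ (Fin.cons ⁅x i.castSucc, x j.succ⁆ (j.removeNth (i.castSucc.removeNth x)))

/-- The bilinear map `(x, y) ↦ ζ([x, y], ⋯)`. -/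
def bracketInsert {m : ℕ} (ζ : L [⋀^Fin (m + 1)]→ₗ[ℝ] V) :
    L →ₗ[ℝ] L →ₗ[ℝ] L [⋀^Fin m]→ₗ[ℝ] V :=
  LinearMap.mk₂ ℝ (fun x y => ζ.curryLeft ⁅x, y⁆) (by simp) (by simp) (by simp) (by simp)

/-- The linear map `x ↦ θ(x) ∘ ζ`. -/
def actInsert (θ : L →ₗ[ℝ] V →ₗ[ℝ] V) {n : ℕ} (ζ : L [⋀^Fin n]→ₗ[ℝ] V) :
    L →ₗ[ℝ] L [⋀^Fin n]→ₗ[ℝ] V where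
  toFun x := (θ x).compAlternatingMap ζ
  map_add' x y := by ext; simp
  map_smul' c x := by ext; simp

lemma ceCobFun_eq (θ : L →ₗ[ℝ] V →ₗ[ℝ] V) {m : ℕ} (ζ : L [⋀^Fin (m + 1)]→ₗ[ℝ] V) :
    ceCobFun θ ζ = ⇑(AlternatingMap.alternatizeUncurryFin (actInsert θ ζ)
      - (1 / 2 : ℝ) • AlternatingMap.alternatizeUncurryFin
        (AlternatingMap.alternatizeUncurryFinLM ∘ₗ bracketInsert ζ)) := by
  ext x
  rw [AlternatingMap.sub_apply, AlternatingMap.smul_apply,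
    AlternatingMap.alternatizeUncurryFin_alternatizeUncurryFinLM_comp_apply,
    AlternatingMap.alternatizeUncurryFin_apply, sub_eq_add_neg, ceCobFun]
  congr 1
  rw [Finset.smul_sum, ← Finset.sum_neg_distrib]
  refine Finset.sum_congr rfl fun i _ => ?_
  rw [Finset.smul_sum, ← Finset.sum_neg_distrib]
  refine Finset.sum_congr rfl fun j _ => ?_
  have h : ∀ (a b : L) (y : Fin m → L), bracketInsert ζ a b y = ζ (Fin.cons ⁅a, b⁆ y) :=
    fun a b y => rfl
  have h' : ∀ (a b : L) (y : Fin m → L), bracketInsert ζ b a y = - bracketInsert ζ a b y := by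
    intro a b y
    have : bracketInsert ζ b a = - bracketInsert ζ a b := by
      change ζ.curryLeft ⁅b, a⁆ = - ζ.curryLeft ⁅a, b⁆
      rw [← lie_skew, map_neg]
    rw [this]; rfl
  rw [h' (x i.castSucc) (x j.succ), sub_neg_eq_add, ← two_smul ℝ, smul_comm (_ : ℤ) (2 : ℝ),
    smul_smul, h]
  norm_num [pow_add, pow_succ]

/-- The Chevalley–Eilenberg coboundary operator on `Hom(⋀ⁿ L, V)`, `n = m + 1`. -/
def ceCob (θ : L →ₗ[ℝ] V →ₗ[ℝ] V) (m : ℕ) :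
    L [⋀^Fin (m + 1)]→ₗ[ℝ] V →ₗ[ℝ] L [⋀^Fin (m + 2)]→ₗ[ℝ] V where
  toFun ζ :=
    { toFun := ceCobFun θ ζ
      map_update_add' := by
        intro inst x i a b
        rw [ceCobFun_eq]
        exact AlternatingMap.map_update_add _ _ _ _ _
      map_update_smul' := by
        intro inst x i c a
        rw [ceCobFun_eq]
        exact AlternatingMap.map_update_smul _ _ _ _ _
      map_eq_zero_of_eq' := by
        intro x i j h hij
        change ceCobFun θ ζ x = 0
        rw [ceCobFun_eq]
        exact AlternatingMap.map_eq_zero_of_eq _ _ h hij }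
  map_add' ζ ξ := by
    ext x
    change ceCobFun θ (ζ + ξ) x = ceCobFun θ ζ x + ceCobFun θ ξ x
    simp only [ceCobFun, AlternatingMap.add_apply, map_add, smul_add, Finset.sum_add_distrib]
    abel
  map_smul' c ζ := by
    ext x
    change ceCobFun θ (c • ζ) x = c • ceCobFun θ ζ x
    simp only [ceCobFun, AlternatingMap.smul_apply, map_smul, smul_add, Finset.smul_sum,
      smul_comm c]

/-- `K(ζ)(x₁, …, xₙ)`: the sum runs over the non-empty sets `{i₁ < ⋯ < i_k}` of positions at
which `D` is applied. -/
def lieKFun (D : L →ₗ[ℝ] L) (T : V →ₗ[ℝ] V) {n : ℕ} (ζ : L [⋀^Fin n]→ₗ[ℝ] V) (x : Fin n → L) : V :=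
  (-1 : ℝ) ^ n • (∑ s : Finset (Fin n) with s.Nonempty, ζ (s.piecewise (fun i => D (x i)) x)
    - T (ζ x))

lemma lieKFun_eq (D : L →ₗ[ℝ] L) (T : V →ₗ[ℝ] V) {n : ℕ} (ζ : L [⋀^Fin n]→ₗ[ℝ] V) :
    lieKFun D T ζ = ⇑((-1 : ℝ) ^ n •
      (ζ.compLinearMap (D + LinearMap.id) - ζ - T.compAlternatingMap ζ) : L [⋀^Fin n]→ₗ[ℝ] V) := by
  ext x
  have h : ζ (fun i => D (x i) + x i) =
      ∑ s : Finset (Fin n), ζ (s.piecewise (fun i => D (x i)) x) :=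
    ζ.toMultilinearMap.map_add_univ (fun i => D (x i)) x
  have h2 : ∑ s : Finset (Fin n) with s.Nonempty, ζ (s.piecewise (fun i => D (x i)) x) =
      ∑ s : Finset (Fin n), ζ (s.piecewise (fun i => D (x i)) x) - ζ x := by
    rw [← Finset.sum_filter_add_sum_filter_not Finset.univ Finset.Nonempty]
    simp [Finset.not_nonempty_iff_eq_empty, Finset.filter_eq']
  rw [lieKFun, h2, ← h]
  rfl

/-- The operator `K` on `Hom(⋀ⁿ L, V)`. -/
def lieK (D : L →ₗ[ℝ] L) (T : V →ₗ[ℝ] V) (n : ℕ) :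
    L [⋀^Fin n]→ₗ[ℝ] V →ₗ[ℝ] L [⋀^Fin n]→ₗ[ℝ] V where
  toFun ζ :=
    { toFun := lieKFun D T ζ
      map_update_add' := by
        intro inst x i a b
        rw [lieKFun_eq]
        exact AlternatingMap.map_update_add _ _ _ _ _
      map_update_smul' := by
        intro inst x i c a
        rw [lieKFun_eq]
        exact AlternatingMap.map_update_smul _ _ _ _ _
      map_eq_zero_of_eq' := by
        intro x i j h hij
        change lieKFun D T ζ x = 0
        rw [lieKFun_eq]
        exact AlternatingMap.map_eq_zero_of_eq _ _ h hij }
  map_add' ζ ξ := by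
    ext x
    change lieKFun D T (ζ + ξ) x = lieKFun D T ζ x + lieKFun D T ξ x
    simp only [lieKFun, AlternatingMap.add_apply, map_add, smul_add, smul_sub,
      Finset.sum_add_distrib]
    abel
  map_smul' c ζ := by
    ext x
    change lieKFun D T (c • ζ) x = c • lieKFun D T ζ x
    simp only [lieKFun, AlternatingMap.smul_apply, map_smul, smul_sub, Finset.smul_sum,
      smul_comm c]

/-- The representation `θ_D(x) = θ(x) + θ(D(x))`. -/
def lieTwist (θ : L →ₗ[ℝ] V →ₗ[ℝ] V) (D : L →ₗ[ℝ] L) : L →ₗ[ℝ] V →ₗ[ℝ] V := θ + θ ∘ₗ D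

end LieAlgebras

/-! Both complexes start in degree `1`. They are indexed by `k = n - 1`. -/

section Complexes
universe u v

/-- For a family `C¹, C², …` of spaces, the space `0` for `k = 0`, and `Cᵏ` for `k ≥ 1`.
This is the space of cochains of degree `n = k + 1` of the difference operator. -/
def OpCochain (C : ℕ → Type u) : ℕ → Type u
  | 0 => PUnit
  | k + 1 => C (k + 1)

variable (C : ℕ → Type u) (C' : ℕ → Type v) [∀ n, AddCommGroup (C n)] [∀ n, Module ℝ (C n)]
  [∀ n, AddCommGroup (C' n)] [∀ n, Module ℝ (C' n)]

instance : ∀ k, AddCommGroup (OpCochain C k)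
  | 0 => inferInstanceAs (AddCommGroup PUnit.{u + 1})
  | k + 1 => inferInstanceAs (AddCommGroup (C (k + 1)))

instance : ∀ k, Module ℝ (OpCochain C k)
  | 0 => (inferInstance : Module ℝ PUnit.{u + 1})
  | k + 1 => inferInstanceAs (Module ℝ (C (k + 1)))

variable {C C'}

/-- The coboundary operator on the cochains of the difference operator, for
`d : Cⁿ → Cⁿ⁺¹`, `n ≥ 1`. -/
def opCob (d : ∀ k, C (k + 1) →ₗ[ℝ] C (k + 2)) : ∀ k, OpCochain C k →ₗ[ℝ] C (k + 1)
  | 0 => 0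
  | k + 1 => d k

/-- The map on cochains of the difference operator given by `f : Cⁿ → C'ⁿ`, `n ≥ 1`. -/
def opMap (f : ∀ n, C n →ₗ[ℝ] C' n) : ∀ k, OpCochain C k →ₗ[ℝ] OpCochain C' k
  | 0 => 0
  | k + 1 => f (k + 1)

/-- `(α, β) ↦ (d α, d' β + K α)`, from degree `n = k + 1` to degree `n + 1`. -/
def totalCob (d d' : ∀ k, C (k + 1) →ₗ[ℝ] C (k + 2)) (K : ∀ n, C n →ₗ[ℝ] C n) (k : ℕ) :
    C (k + 1) × OpCochain C k →ₗ[ℝ] C (k + 2) × OpCochain C (k + 1) :=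
  LinearMap.prod (d k ∘ₗ LinearMap.fst ℝ _ _)
    (opCob d' k ∘ₗ LinearMap.snd ℝ _ _ + K (k + 1) ∘ₗ LinearMap.fst ℝ _ _ :
      C (k + 1) × OpCochain C k →ₗ[ℝ] C (k + 1))

/-- `(α, β) ↦ (f α, f β)` in degree `n = k + 1`. -/
def totalMap (f : ∀ n, C n →ₗ[ℝ] C' n) (k : ℕ) :
    C (k + 1) × OpCochain C k →ₗ[ℝ] C' (k + 1) × OpCochain C' k :=
  (f (k + 1)).prodMap (opMap f k)

variable {X : ℕ → Type*} [∀ k, AddCommGroup (X k)] [∀ k, Module ℝ (X k)]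

/-- The coboundaries of a complex `X 0 → X 1 → ⋯`. -/
def coboundaries (δ : ∀ k, X k →ₗ[ℝ] X (k + 1)) : ∀ k, Submodule ℝ (X k)
  | 0 => ⊥
  | k + 1 => LinearMap.range (δ k)

/-- The cohomology (cocycles modulo coboundaries) of a complex `X 0 → X 1 → ⋯`. -/
abbrev Cohomology (δ : ∀ k, X k →ₗ[ℝ] X (k + 1)) (k : ℕ) : Type _ :=
  LinearMap.ker (δ k) ⧸ (coboundaries δ k).submoduleOf (LinearMap.ker (δ k))

/-- The class of a cocycle. -/
abbrev cohClass (δ : ∀ k, X k →ₗ[ℝ] X (k + 1)) (k : ℕ) (z : LinearMap.ker (δ k)) :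
    Cohomology δ k :=
  Submodule.Quotient.mk z

end Complexes

section VanEst
variable {d : ℕ} {G : Type*} [TopologicalSpace G] [ChartedSpace (EuclideanSpace ℝ (Fin d)) G]
  [Group G] [LieGroup (𝓡 d) ∞ G]
  {V : Type*} [NormedAddCommGroup V] [NormedSpace ℝ V] [FiniteDimensional ℝ V]

/-- The derivative at the identity of the difference operator; `D(1) = 1`, so the target is again
the tangent space at the identity. -/
def DifferenceOperator.lie (D : DifferenceOperator d G) :
    GroupLieAlgebra (𝓡 d) G →ₗ[ℝ] GroupLieAlgebra (𝓡 d) G :=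
  (mfderiv (𝓡 d) (𝓡 d) D 1 : EuclideanSpace ℝ (Fin d) →L[ℝ] EuclideanSpace ℝ (Fin d)).toLinearMap

/-- The derivative at the identity of a representation of `G`. -/
def SmoothRep.lie (Θ : SmoothRep d G V) : GroupLieAlgebra (𝓡 d) G →ₗ[ℝ] V →ₗ[ℝ] V :=
  ContinuousLinearMap.coeLM ℝ ∘ₗ
    (mfderiv (𝓡 d) 𝓘(ℝ, V →L[ℝ] V) (fun g => Θ g) 1 :
      EuclideanSpace ℝ (Fin d) →L[ℝ] V →L[ℝ] V).toLinearMap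

variable (d G V) in
/-- `Hom(⋀ⁿ 𝔤, V)` -/
abbrev LieCochain (n : ℕ) : Type _ := GroupLieAlgebra (𝓡 d) G [⋀^Fin n]→ₗ[ℝ] V

/-- The coboundary operator of the difference Lie group in degree `n = k + 1`. -/
def groupDelta {D : DifferenceOperator d G} (ρ : DifferenceRep V D) (k : ℕ) :
    GroupCochain d G V (k + 1) × OpCochain (fun n => GroupCochain d G V n) k →ₗ[ℝ]
      GroupCochain d G V (k + 2) × OpCochain (fun n => GroupCochain d G V n) (k + 1) :=
  totalCob (C := fun n => GroupCochain d G V n) (fun k => groupCob ρ.Θ (k + 1))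
    (fun k => groupCob (ρ.Θ.twist D) (k + 1)) (groupK ρ) k

/-- The coboundary operator of the difference Lie algebra `(𝔤, D_*)` with coefficients in
`(V, T, Θ_*)`, in degree `n = k + 1`. -/
def lieDelta {D : DifferenceOperator d G} (ρ : DifferenceRep V D) (k : ℕ) :
    LieCochain d G V (k + 1) × OpCochain (LieCochain d G V) k →ₗ[ℝ]
      LieCochain d G V (k + 2) × OpCochain (LieCochain d G V) (k + 1) :=
  totalCob (C := LieCochain d G V) (ceCob ρ.Θ.lie) (ceCob (lieTwist ρ.Θ.lie D.lie))
    (lieK D.lie ρ.T) k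

/-- `∂/∂t₁ ⋯ ∂/∂tₙ F` at `t₁ = ⋯ = tₙ = 0`. -/
def mixedDeriv : (n : ℕ) → ((Fin n → ℝ) → V) → V
  | 0, F => F ![]
  | n + 1, F => deriv (fun t => mixedDeriv n fun s => F (Fin.cons t s)) 0

/-- The formula for the van Est map; the variable `t i` is the one attached to `x (ε i)`. -/
def vanEstFun [T2Space G] {n : ℕ} (α : (Fin n → G) → V) (x : Fin n → GroupLieAlgebra (𝓡 d) G) : V :=
  ∑ ε : Equiv.Perm (Fin n), (Equiv.Perm.sign ε : ℤ) •
    mixedDeriv n fun t => α fun i => lieExp (t i • x (ε i))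

end VanEst
end
end DiffLie

open DiffLie

/-! Everything rests on one object, `expJet α u`: the mixed derivative of `α` at the identity along
the one-parameter subgroups `exp(tᵢ uᵢ)`. In the chart at the identity it is the `n`-th derivative
of `α` on the vectors that carry `uᵢ` in slot `i` and zero elsewhere. Hence it is multilinear in
`u`, and the one-parameter subgroups may be replaced by any curves with the same velocities
(`mixedDeriv_comp_curves`). The van Est map is its antisymmetrization `altSum`.

Coboundaries (`vanEst_groupCob`). In the jet of `d^Θ α` the first term gives `θ(u₀)` applied to the
jet of `α`, and the last term does not involve the last variable, so it gives zero. The jet of a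
middle term `α(…, gₖ gₖ₊₁, …)` is not symmetric in `uₖ, uₖ₊₁`. Its defect is the jet of `α` with
`[uₖ, uₖ₊₁]` in slot `k`, because `X(Yf) - Y(Xf) = [X, Y]f` for left-invariant fields
(`expJet_contractNth_sub_swap`). Antisymmetrization turns each middle term into half the
antisymmetrization of its defect, and the Chevalley–Eilenberg coboundary of an antisymmetrization
has exactly this form (`ceCobFun_eq_altSum`).

The operator `K` (`vanEst_groupK`). If `c` has velocity `x`, then `D(c)c` has velocity `Dx + x`; so
`h(α)` goes to `ζ(Dx₁ + x₁, …) - ζ - Tζ` up to sign, which expands over non-empty sets of positions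
to `K(ζ)`. The part `p(α)` goes to zero: it is minus the restriction of `d^Θ α` to the graph `g ↦
(D(g), g)` in degree one, and the `Θ_D`-coboundary of the restriction of `α` in degree two. A
normalized 2-cochain vanishes on both axes, so its differential at `(1, 1)` is zero and the van Est
map kills its graph restriction.

The same velocity computation shows that `Θ_D` differentiates to `θ_D`. Both components of the total
coboundary are then intertwined, and the passage to cohomology is formal. -/

namespace DiffLie
noncomputable section

/-! ### Antisymmetrization of functions of several variables -/

section Alternation
variable {X V : Type*} [AddCommGroup V]

/-- The antisymmetrization `x ↦ ∑ ε, sign ε • A (x ∘ ε)` of a function of `n` variables. -/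
def altSum {n : ℕ} (A : (Fin n → X) → V) (x : Fin n → X) : V :=
  ∑ ε : Equiv.Perm (Fin n), (Equiv.Perm.sign ε : ℤ) • A fun i => x (ε i)

lemma altSum_add {n : ℕ} (A B : (Fin n → X) → V) (x : Fin n → X) :
    altSum (fun u => A u + B u) x = altSum A x + altSum B x := by
  simp only [altSum, smul_add, Finset.sum_add_distrib]

lemma altSum_sum {n : ℕ} {ι : Type*} (s : Finset ι) (A : ι → (Fin n → X) → V) (x : Fin n → X) :
    altSum (fun u => ∑ k ∈ s, A k u) x = ∑ k ∈ s, altSum (A k) x := by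
  simp only [altSum, Finset.smul_sum]
  exact Finset.sum_comm

lemma altSum_map {n : ℕ} {W : Type*} [AddCommGroup W] (f : V →+ W) (A : (Fin n → X) → V)
    (x : Fin n → X) : altSum (fun u => f (A u)) x = f (altSum A x) := by
  simp only [altSum, map_sum, map_zsmul]

lemma altSum_comp_perm {n : ℕ} (A : (Fin n → X) → V) (σ : Equiv.Perm (Fin n)) (x : Fin n → X) :
    altSum (fun u => A fun i => u (σ i)) x = (Equiv.Perm.sign σ : ℤ) • altSum A x := by
  simp only [altSum, Finset.smul_sum]
  refine Fintype.sum_equiv (Equiv.mulRight σ) _ _ fun ε => ?_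
  have h : (Equiv.Perm.sign σ : ℤ) * (Equiv.Perm.sign ε * Equiv.Perm.sign σ : ℤ) =
      Equiv.Perm.sign ε := by
    rw [mul_left_comm, Int.units_coe_mul_self, mul_one]
  simp only [Equiv.coe_mulRight, Equiv.Perm.sign_mul, Units.val_mul, smul_smul, h]
  rfl

/-- The permutation of `Fin (n + 1)` that fixes `0` and acts on the successors by `τ`. -/
def permSucc {n : ℕ} (τ : Equiv.Perm (Fin n)) : Equiv.Perm (Fin (n + 1)) :=
  Equiv.Perm.decomposeFin.symm (0, τ)

@[simp] lemma permSucc_zero {n : ℕ} (τ : Equiv.Perm (Fin n)) : permSucc τ 0 = 0 := by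
  simp [permSucc]

@[simp] lemma permSucc_succ {n : ℕ} (τ : Equiv.Perm (Fin n)) (i : Fin n) :
    permSucc τ i.succ = (τ i).succ := by
  simp [permSucc]

@[simp] lemma sign_permSucc {n : ℕ} (τ : Equiv.Perm (Fin n)) :
    Equiv.Perm.sign (permSucc τ) = Equiv.Perm.sign τ := by
  simp [permSucc]

lemma permSucc_injective {n : ℕ} : Function.Injective (permSucc (n := n)) := by
  intro σ τ h
  simpa [permSucc] using h

lemma cons_comp_permSucc {n : ℕ} (z : X) (y : Fin n → X) (τ : Equiv.Perm (Fin n)) :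
    (fun i => (Fin.cons z y : Fin (n + 1) → X) (permSucc τ i)) = Fin.cons z fun i => y (τ i) := by
  ext i
  refine Fin.cases ?_ (fun i => ?_) i <;> simp

/-- Coset decomposition of the symmetric group by the stabilizer of `0`: the image of `0` determines
the coset, and the cardinalities agree. The cycle for `i` has sign `(-1)^i`, the source of the
alternating signs in both expansions below. -/
lemma cycleRange_symm_mul_permSucc_bijective (n : ℕ) :
    Function.Bijective fun p : Fin (n + 1) × Equiv.Perm (Fin n) =>
      p.1.cycleRange.symm * permSucc p.2 := by
  rw [Fintype.bijective_iff_injective_and_card]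
  refine ⟨?_, by simp [Fintype.card_perm, Nat.factorial_succ]⟩
  rintro ⟨i, σ⟩ ⟨j, τ⟩ h
  have hij : i = j := by simpa using congrArg (fun f : Equiv.Perm (Fin (n + 1)) => f 0) h
  subst hij
  simpa using permSucc_injective (mul_left_cancel h)

/-- Expansion of the antisymmetrization along the first variable. -/
lemma altSum_succ {n : ℕ} (A : (Fin (n + 1) → X) → V) (x : Fin (n + 1) → X) :
    altSum A x = ∑ i : Fin (n + 1), (-1 : ℤ) ^ i.val •
      altSum (fun y => A (Fin.cons (x i) y)) (i.removeNth x) := by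
  simp only [altSum, Finset.smul_sum]
  rw [← Fintype.sum_prod_type']
  refine (Fintype.sum_equiv (Equiv.ofBijective _ (cycleRange_symm_mul_permSucc_bijective n))
    _ _ fun p => ?_).symm
  rw [smul_smul]
  congr 1
  · simp
  · congr 1
    ext i
    refine Fin.cases ?_ (fun i => ?_) i
    · simp
    · simp [Fin.removeNth]

/-- Expansion of the antisymmetrization along the first entry of the argument. -/
lemma altSum_cons {n : ℕ} (A : (Fin (n + 1) → X) → V) (z : X) (y : Fin n → X) :
    altSum A (Fin.cons z y) = ∑ k : Fin (n + 1), (-1 : ℤ) ^ k.val •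
      altSum (fun w => A (k.insertNth z w)) y := by
  simp only [altSum, Finset.smul_sum]
  rw [← Fintype.sum_prod_type']
  -- The entry `z` lands in the slot `k` that `ε` sends to `0`, so `ε⁻¹` rather than `ε` has to be
  -- decomposed. Inverting the second factor beforehand makes `ε = permSucc τ * k.cycleRange`.
  refine (Fintype.sum_equiv ((Equiv.refl _).prodCongr (Equiv.inv _) |>.trans
    (Equiv.ofBijective _ (cycleRange_symm_mul_permSucc_bijective n)) |>.trans (Equiv.inv _))
    _ _ fun p => ?_).symm
  have h : ∀ τ : Equiv.Perm (Fin n), (permSucc τ⁻¹)⁻¹ = permSucc τ := by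
    intro τ
    rw [inv_eq_iff_mul_eq_one]
    ext i
    refine Fin.cases ?_ (fun i => ?_) i <;> simp
  have e : (p.1.cycleRange.symm * permSucc p.2⁻¹)⁻¹ = permSucc p.2 * p.1.cycleRange := by
    rw [mul_inv_rev, h]; rfl
  simp only [Equiv.trans_apply, Equiv.prodCongr_apply, Prod.map, Equiv.refl_apply,
    Equiv.ofBijective_apply, Equiv.inv_apply, e]
  rw [smul_smul]
  congr 1
  · simp [mul_comm]
  · congr 1
    rw [← Fin.cons_comp_cycleRange, ← cons_comp_permSucc]
    rfl

/-- Moving the slots `k, k + 1` to the front, with the order of the rest unchanged, takes two cycles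
of sign `(-1)^k` each, hence an even permutation. -/
lemma altSum_adjacent_pair {m : ℕ} (B : X → X → (Fin m → X) → V) (k : Fin (m + 1))
    (x : Fin (m + 2) → X) :
    altSum (fun u => B (u k.castSucc) (u k.succ) (k.removeNth (k.castSucc.removeNth u))) x =
      altSum (fun u => B (u 0) (u 1) fun i => u i.succ.succ) x := by
  have h := altSum_comp_perm (fun u : Fin (m + 2) → X => B (u 0) (u 1) fun i => u i.succ.succ)
    (k.castSucc.cycleRange.symm * permSucc k.cycleRange.symm) x
  have hs : Equiv.Perm.sign (k.castSucc.cycleRange.symm * permSucc k.cycleRange.symm) = 1 := by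
    simp [← mul_pow]
  rw [hs, Units.val_one, one_smul] at h
  rw [← h]
  have e1 : permSucc k.cycleRange.symm 1 = k.succ := by
    have := permSucc_succ k.cycleRange.symm 0
    rwa [Fin.cycleRange_symm_zero, Fin.succ_zero_eq_one] at this
  have e2 : k.castSucc.succAbove k = k.succ := Fin.succAbove_castSucc_self k
  simp only [Equiv.Perm.mul_apply, permSucc_zero, Fin.cycleRange_symm_zero, e1,
    Fin.cycleRange_symm_succ, e2, permSucc_succ]
  rfl

/-- A transposition of the variables negates the antisymmetrization, so antisymmetrizing `B - B ∘
swap` gives twice that of `B`. -/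
lemma altSum_eq_half_smul [Module ℝ V] {n : ℕ} {B C : (Fin n → X) → V}
    {i j : Fin n} (hij : i ≠ j) (h : ∀ u, B u - B (fun l => u (Equiv.swap i j l)) = C u)
    (x : Fin n → X) : altSum B x = (1 / 2 : ℝ) • altSum C x := by
  have h1 : altSum B x = altSum C x + altSum (fun u => B fun l => u (Equiv.swap i j l)) x := by
    rw [← altSum_add]
    congr 1
    ext u
    rw [← h, sub_add_cancel]
  rw [altSum_comp_perm, Equiv.Perm.sign_swap hij] at h1
  have h2 : altSum C x = (2 : ℝ) • altSum B x := by
    rw [two_smul]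
    nth_rewrite 1 [h1]
    simp
  rw [h2, smul_smul]
  norm_num

end Alternation

/-! ### The Chevalley–Eilenberg coboundary of an antisymmetrization -/

section ChevalleyEilenberg
variable {L V : Type*} [LieRing L] [LieAlgebra ℝ L] [AddCommGroup V] [Module ℝ V]

/-- The Chevalley–Eilenberg coboundary of an antisymmetrization. -/
lemma ceCobFun_eq_altSum (θ : L →ₗ[ℝ] V →ₗ[ℝ] V) {m : ℕ} (ζ : L [⋀^Fin (m + 1)]→ₗ[ℝ] V)
    (A : (Fin (m + 1) → L) → V) (hζ : ∀ y, ζ y = altSum A y) (x : Fin (m + 2) → L) :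
    ceCobFun θ ζ x = altSum (fun u => θ (u 0) (A fun i => u i.succ)) x
      - (1 / 2 : ℝ) • ∑ k : Fin (m + 1), (-1 : ℤ) ^ k.val • altSum (fun u =>
          A (k.insertNth ⁅u k.castSucc, u k.succ⁆ (k.removeNth (k.castSucc.removeNth u)))) x := by
  rw [ceCobFun_eq, AlternatingMap.sub_apply, AlternatingMap.smul_apply,
    AlternatingMap.alternatizeUncurryFin_apply, AlternatingMap.alternatizeUncurryFin_apply]
  congr 1
  · rw [altSum_succ]
    refine Finset.sum_congr rfl fun i _ => ?_
    congr 1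
    change θ (x i) (ζ _) = _
    rw [hζ]
    exact (altSum_map (θ (x i)).toAddMonoidHom A _).symm
  · congr 1
    -- Move the bracketed pair to the front and expand along its two entries: this yields the double
    -- sum over `i, j` of the iterated alternatization. On the other side, expanding `ζ` along its
    -- first entry, the bracket, supplies the sum over `k`.
    have e : ∀ k : Fin (m + 1), altSum (fun u =>
          A (k.insertNth ⁅u k.castSucc, u k.succ⁆ (k.removeNth (k.castSucc.removeNth u)))) x =
        ∑ i : Fin (m + 2), ∑ j : Fin (m + 1), (-1 : ℤ) ^ i.val • (-1 : ℤ) ^ j.val •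
          altSum (fun w => A (k.insertNth ⁅x i, i.removeNth x j⁆ w))
            (j.removeNth (i.removeNth x)) := by
      intro k
      rw [altSum_adjacent_pair (fun a b w => A (k.insertNth ⁅a, b⁆ w)), altSum_succ]
      refine Finset.sum_congr rfl fun i _ => ?_
      rw [altSum_succ, Finset.smul_sum]
      rfl
    simp only [e, Finset.smul_sum]
    rw [Finset.sum_comm]
    refine Finset.sum_congr rfl fun i _ => ?_
    rw [LinearMap.comp_apply, AlternatingMap.alternatizeUncurryFinLM_apply,
      AlternatingMap.alternatizeUncurryFin_apply, Finset.smul_sum, Finset.sum_comm]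
    refine Finset.sum_congr rfl fun j _ => ?_
    change _ • _ • ζ (Fin.cons ⁅x i, i.removeNth x j⁆ (j.removeNth (i.removeNth x))) = _
    rw [hζ, altSum_cons, Finset.smul_sum, Finset.smul_sum]
    refine Finset.sum_congr rfl fun k _ => ?_
    rw [smul_comm ((-1 : ℤ) ^ j.val), smul_comm ((-1 : ℤ) ^ i.val)]

lemma ceCob_apply (θ : L →ₗ[ℝ] V →ₗ[ℝ] V) {m : ℕ} (ζ : L [⋀^Fin (m + 1)]→ₗ[ℝ] V)
    (x : Fin (m + 2) → L) : ceCob θ m ζ x = ceCobFun θ ζ x := rfl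

/-- By multilinearity `ζ(Dx₁ + x₁, …)` is the sum over all sets of positions; the empty set accounts
for the subtracted `ζ(x)`. -/
lemma lieK_apply (D : L →ₗ[ℝ] L) (T : V →ₗ[ℝ] V) {n : ℕ} (ζ : L [⋀^Fin n]→ₗ[ℝ] V)
    (x : Fin n → L) : lieK D T n ζ x =
      (-1 : ℝ) ^ n • (ζ (fun i => D (x i) + x i) - ζ x - T (ζ x)) := by
  change lieKFun D T ζ x = _
  rw [lieKFun_eq]
  rfl

end ChevalleyEilenberg

/-! ### Cochain maps of the total complexes and cohomology -/

section Cohomology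
universe u v
variable {C : ℕ → Type u} {C' : ℕ → Type v} [∀ n, AddCommGroup (C n)] [∀ n, Module ℝ (C n)]
  [∀ n, AddCommGroup (C' n)] [∀ n, Module ℝ (C' n)]

lemma totalMap_comp_totalCob (f : ∀ n, C n →ₗ[ℝ] C' n) (d d' : ∀ k, C (k + 1) →ₗ[ℝ] C (k + 2))
    (e e' : ∀ k, C' (k + 1) →ₗ[ℝ] C' (k + 2)) (K : ∀ n, C n →ₗ[ℝ] C n) (K' : ∀ n, C' n →ₗ[ℝ] C' n)
    (hd : ∀ k, f (k + 2) ∘ₗ d k = e k ∘ₗ f (k + 1))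
    (hd' : ∀ k, f (k + 2) ∘ₗ d' k = e' k ∘ₗ f (k + 1))
    (hK : ∀ n, 1 ≤ n → f n ∘ₗ K n = K' n ∘ₗ f n) (k : ℕ) :
    totalMap f (k + 1) ∘ₗ totalCob d d' K k = totalCob e e' K' k ∘ₗ totalMap f k := by
  have h : ∀ b, f (k + 1) (opCob d' k b) = opCob e' k (opMap f k b) := by
    intro b
    cases k with
    -- In degree one there is no operator cochain and its coboundary is zero by convention.
    | zero => exact map_zero _
    | succ k => exact LinearMap.congr_fun (hd' k) b
  refine LinearMap.ext fun z => Prod.ext ?_ ?_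
  · exact LinearMap.congr_fun (hd k) z.1
  · change f (k + 1) (opCob d' k z.2 + K (k + 1) z.1) =
      opCob e' k (opMap f k z.2) + K' (k + 1) (f (k + 1) z.1)
    rw [map_add, h]
    exact congrArg _ (LinearMap.congr_fun (hK (k + 1) (Nat.le_add_left 1 k)) z.1)

variable {X Y : ℕ → Type*} [∀ k, AddCommGroup (X k)] [∀ k, Module ℝ (X k)]
  [∀ k, AddCommGroup (Y k)] [∀ k, Module ℝ (Y k)]

/-- A cochain map induces a linear map in cohomology. -/
lemma exists_cohomology_map (δ : ∀ k, X k →ₗ[ℝ] X (k + 1)) (δ' : ∀ k, Y k →ₗ[ℝ] Y (k + 1))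
    (f : ∀ k, X k →ₗ[ℝ] Y k) (hf : ∀ k, f (k + 1) ∘ₗ δ k = δ' k ∘ₗ f k) (k : ℕ) :
    ∃ φ : Cohomology δ k →ₗ[ℝ] Cohomology δ' k,
      ∀ z : LinearMap.ker (δ k), ∃ w : LinearMap.ker (δ' k),
        w.1 = f k z.1 ∧ φ (cohClass δ k z) = cohClass δ' k w := by
  have hker : ∀ z ∈ LinearMap.ker (δ k), f k z ∈ LinearMap.ker (δ' k) := by
    intro z hz
    rw [LinearMap.mem_ker] at hz ⊢
    have := LinearMap.congr_fun (hf k) z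
    rw [LinearMap.comp_apply, LinearMap.comp_apply, hz, map_zero] at this
    exact this.symm
  refine ⟨Submodule.mapQ _ _ ((f k).restrict hker) ?_, fun z => ⟨⟨f k z.1, hker _ z.2⟩, rfl, rfl⟩⟩
  rintro ⟨z, hz⟩ hzc
  change f k z ∈ coboundaries δ' k
  change z ∈ coboundaries δ k at hzc
  cases k with
  | zero =>
    have h0 : z = 0 := hzc
    rw [h0, map_zero]
    exact zero_mem _
  | succ k =>
    obtain ⟨y, rfl⟩ := hzc
    exact ⟨f k y, (LinearMap.congr_fun (hf k) y).symm⟩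

end Cohomology

/-! ### Mixed derivatives in vector spaces -/

section MixedDerivative
variable {V : Type*} [NormedAddCommGroup V] [NormedSpace ℝ V]

lemma mixedDeriv_succ (n : ℕ) (F : (Fin (n + 1) → ℝ) → V) :
    mixedDeriv (n + 1) F = deriv (fun t => mixedDeriv n fun s => F (Fin.cons t s)) 0 := rfl

/-- Adapts neighbourhoods of the origin to `mixedDeriv`, which differentiates one variable at a
time. -/
lemma eventually_eventually_cons {n : ℕ} {p : (Fin (n + 1) → ℝ) → Prop} (h : ∀ᶠ t in 𝓝 0, p t) :
    ∀ᶠ t in 𝓝 (0 : ℝ), ∀ᶠ s in 𝓝 (0 : Fin n → ℝ), p (Fin.cons t s) := by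
  have hc : Continuous fun q : ℝ × (Fin n → ℝ) => (Fin.cons q.1 q.2 : Fin (n + 1) → ℝ) := by
    refine continuous_pi fun i => ?_
    refine Fin.cases ?_ (fun i => ?_) i
    · exact continuous_fst
    · exact (continuous_apply i).comp continuous_snd
  have h0 : (Fin.cons (0 : ℝ) (0 : Fin n → ℝ) : Fin (n + 1) → ℝ) = 0 := by
    ext i
    refine Fin.cases ?_ (fun i => ?_) i <;> simp
  have h1 : Tendsto (fun q : ℝ × (Fin n → ℝ) => (Fin.cons q.1 q.2 : Fin (n + 1) → ℝ))
      (𝓝 (0, 0)) (𝓝 0) := by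
    have := hc.tendsto (0, 0)
    rwa [h0] at this
  have h2 := h1.eventually h
  rw [nhds_prod_eq] at h2
  exact h2.curry

lemma mixedDeriv_congr : ∀ {n : ℕ} {F F' : (Fin n → ℝ) → V} (_ : ∀ᶠ t in 𝓝 0, F t = F' t),
    mixedDeriv n F = mixedDeriv n F'
  | 0, F, F', h => by
    have := h.self_of_nhds
    rwa [Subsingleton.elim (0 : Fin 0 → ℝ) ![]] at this
  | n + 1, F, F', h => by
    refine EventuallyEq.deriv_eq ?_
    filter_upwards [eventually_eventually_cons h] with t ht
    exact mixedDeriv_congr ht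

/-- The last variable carries the innermost derivative, which here differentiates a constant. -/
lemma mixedDeriv_castSucc : ∀ (n : ℕ) (F : (Fin n → ℝ) → V),
    mixedDeriv (n + 1) (fun t => F fun i => t i.castSucc) = 0
  | 0, F => by
    rw [mixedDeriv_succ]
    have : (fun t : ℝ => mixedDeriv 0 fun s => F fun i : Fin 0 =>
        (Fin.cons t s : Fin 1 → ℝ) i.castSucc) = fun _ => F ![] := by
      ext t
      exact congrArg F (Subsingleton.elim _ _)
    rw [this, deriv_const]
  | n + 1, F => by
    rw [mixedDeriv_succ]
    have : (fun t : ℝ => mixedDeriv (n + 1) fun s => F fun i : Fin (n + 1) =>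
        (Fin.cons t s : Fin (n + 2) → ℝ) i.castSucc) = fun _ => 0 := by
      ext t
      rw [← mixedDeriv_castSucc n fun s => F (Fin.cons t s)]
      congr 1
      ext s
      congr 1
      ext i
      refine Fin.cases ?_ (fun i => ?_) i
      · rfl
      · rw [← Fin.succ_castSucc, Fin.cons_succ, Fin.cons_succ]
    rw [this, deriv_const]

variable {W : Type*} [NormedAddCommGroup W] [NormedSpace ℝ W]

/-- The mixed derivative along a sum of curves only sees their velocities. -/
lemma mixedDeriv_comp_sum {β : W → V} : ∀ {n : ℕ} {q : W} {κ : Fin n → ℝ → W} {w : Fin n → W}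
    (_ : ContDiffAt ℝ n β q) (_ : ∀ i, κ i 0 = 0) (_ : ∀ i, HasDerivAt (κ i) (w i) 0),
    mixedDeriv n (fun t => β (q + ∑ i, κ i (t i))) = iteratedFDeriv ℝ n β q w
  | 0, q, κ, w, _, _, _ => by simp [mixedDeriv]
  | n + 1, q, κ, w, hβ, h0, hκ => by
    have hc : Tendsto (fun t => q + κ 0 t) (𝓝 0) (𝓝 q) := by
      have := ((hκ 0).continuousAt.tendsto).const_add q
      rwa [h0, add_zero] at this
    -- Freezing the first variable at `t` moves the base point to `q + κ 0 t`. For small `t` the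
    -- function `β` is still smooth enough there, so the induction hypothesis applies at the moved
    -- point.
    have hev : ∀ᶠ t in 𝓝 (0 : ℝ), mixedDeriv n
        (fun s => β (q + ∑ i, κ i ((Fin.cons t s : Fin (n + 1) → ℝ) i))) =
        iteratedFDeriv ℝ n β (q + κ 0 t) (Fin.tail w) := by
      filter_upwards [hc.eventually (hβ.eventually (by simp))] with t ht
      rw [← mixedDeriv_comp_sum (κ := fun i => κ i.succ) (w := Fin.tail w)
        (ht.of_le (by exact_mod_cast Nat.le_succ n))
        (fun i => h0 i.succ) (fun i => hκ i.succ)]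
      simp only [Fin.sum_univ_succ, Fin.cons_zero, Fin.cons_succ, add_assoc]
    rw [mixedDeriv_succ, EventuallyEq.deriv_eq hev, iteratedFDeriv_succ_apply_left]
    have hd : DifferentiableAt ℝ (iteratedFDeriv ℝ n β) (q + κ 0 0) := by
      rw [h0, add_zero]
      exact hβ.differentiableAt_iteratedFDeriv (by exact_mod_cast Nat.lt_succ_self n)
    have h1 := hd.hasFDerivAt.comp_hasDerivAt (0 : ℝ) ((hκ 0).const_add q)
    have h2 := ((ContinuousMultilinearMap.apply ℝ (fun _ : Fin n => W) V
      (Fin.tail w)).hasFDerivAt).comp_hasDerivAt (0 : ℝ) h1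
    have h3 := h2.deriv
    rw [h0, add_zero] at h3
    exact h3

end MixedDerivative

/-! ### Curves through the identity and their velocities -/

lemma mfderiv_eq_id_of_eq {d : ℕ} {G : Type*} [TopologicalSpace G]
    [ChartedSpace (EuclideanSpace ℝ (Fin d)) G] {f : G → G} (hf : ∀ g, f g = g) (g : G) :
    (mfderiv (𝓡 d) (𝓡 d) f g : EuclideanSpace ℝ (Fin d) →L[ℝ] EuclideanSpace ℝ (Fin d)) =
      ContinuousLinearMap.id ℝ _ := by
  obtain rfl : f = id := funext hf
  exact mfderiv_id

section Velocity
variable {d : ℕ} {G : Type*} [TopologicalSpace G] [ChartedSpace (EuclideanSpace ℝ (Fin d)) G]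
  [Group G] {V : Type*} [NormedAddCommGroup V] [NormedSpace ℝ V]
  {E' H' M : Type*} [NormedAddCommGroup E'] [NormedSpace ℝ E']
  [TopologicalSpace H'] [TopologicalSpace M] [ChartedSpace H' M]

/-- The derivative at the identity, as a map between the model spaces. -/
def derivOne (J : ModelWithCorners ℝ E' H') (f : G → M) : EuclideanSpace ℝ (Fin d) →L[ℝ] E' :=
  mfderiv (𝓡 d) J f 1

/-- The curve `c` passes at time `0` through the identity, with velocity `x`. -/
def HasVelocity (c : ℝ → G) (x : EuclideanSpace ℝ (Fin d)) : Prop :=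
  c 0 = 1 ∧ HasMFDerivAt 𝓘(ℝ, ℝ) (𝓡 d) c 0
    (ContinuousLinearMap.smulRight (1 : ℝ →L[ℝ] ℝ) x : ℝ →L[ℝ] EuclideanSpace ℝ (Fin d))

lemma HasVelocity.tendsto {c : ℝ → G} {x : EuclideanSpace ℝ (Fin d)} (hc : HasVelocity c x) :
    Tendsto c (𝓝 0) (𝓝 1) := by
  have := hc.2.continuousAt.tendsto
  rwa [hc.1] at this

lemma clm_comp_smulRight_one {E F : Type*} [NormedAddCommGroup E] [NormedSpace ℝ E]
    [NormedAddCommGroup F] [NormedSpace ℝ F] (A : E →L[ℝ] F) (v : E) :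
    A ∘L ContinuousLinearMap.smulRight (1 : ℝ →L[ℝ] ℝ) v =
      ContinuousLinearMap.smulRight (1 : ℝ →L[ℝ] ℝ) (A v) := by
  ext1; simp

lemma HasVelocity.comp_hasMFDerivAt {J : ModelWithCorners ℝ E' H'} {c : ℝ → G}
    {x : EuclideanSpace ℝ (Fin d)} (hc : HasVelocity c x) {f : G → M}
    (hf : MDifferentiableAt (𝓡 d) J f 1) :
    HasMFDerivAt 𝓘(ℝ, ℝ) J (fun t => f (c t)) 0
      (ContinuousLinearMap.smulRight (1 : ℝ →L[ℝ] ℝ) (derivOne J f x) : ℝ →L[ℝ] E') := by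
  have h1 : HasMFDerivAt (𝓡 d) J f (c 0)
      (derivOne J f : EuclideanSpace ℝ (Fin d) →L[ℝ] E') := by
    rw [hc.1]; exact hf.hasMFDerivAt
  have h2 := h1.comp (0 : ℝ) hc.2
  have e := clm_comp_smulRight_one (derivOne J f) x
  exact h2.congr_mfderiv e

lemma HasVelocity.comp {c : ℝ → G} {x : EuclideanSpace ℝ (Fin d)} (hc : HasVelocity c x)
    {f : G → G} (hf : MDifferentiableAt (𝓡 d) (𝓡 d) f 1) (h1 : f 1 = 1) :
    HasVelocity (fun t => f (c t)) (derivOne (𝓡 d) f x) :=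
  ⟨(congrArg f hc.1).trans h1, hc.comp_hasMFDerivAt hf⟩

lemma HasVelocity.hasDerivAt {c : ℝ → G} {x : EuclideanSpace ℝ (Fin d)} (hc : HasVelocity c x)
    {f : G → V} (hf : MDifferentiableAt (𝓡 d) 𝓘(ℝ, V) f 1) :
    HasDerivAt (fun t => f (c t)) (derivOne 𝓘(ℝ, V) f x) 0 := by
  have h : HasFDerivAt (fun t => f (c t))
      (ContinuousLinearMap.smulRight (1 : ℝ →L[ℝ] ℝ) (derivOne 𝓘(ℝ, V) f x)) 0 :=
    (hc.comp_hasMFDerivAt hf).hasFDerivAt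
  simpa using h.hasDerivAt

lemma mulInvariantVectorField_of_eq_one (x : GroupLieAlgebra (𝓡 d) G) {g : G} (hg : g = 1) :
    (mulInvariantVectorField x g : EuclideanSpace ℝ (Fin d)) = x := by
  subst hg
  exact DFunLike.congr_fun (mfderiv_eq_id_of_eq (d := d) (f := fun z : G => 1 * z)
    (fun g => one_mul g) 1) (x : EuclideanSpace ℝ (Fin d))

lemma DifferenceOperator.hasVelocity (D : DifferenceOperator d G) {c : ℝ → G}
    {x : GroupLieAlgebra (𝓡 d) G} (hc : HasVelocity c x) :
    HasVelocity (fun t => D (c t)) (D.lie x) :=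
  hc.comp (D.smooth.mdifferentiableAt (by simp)) D.map_one

lemma hasVelocity_const : HasVelocity (fun _ : ℝ => (1 : G)) (0 : EuclideanSpace ℝ (Fin d)) := by
  refine ⟨rfl, (hasMFDerivAt_const (1 : G) (0 : ℝ)).congr_mfderiv ?_⟩
  have e : (0 : ℝ →L[ℝ] EuclideanSpace ℝ (Fin d)) =
    ContinuousLinearMap.smulRight (1 : ℝ →L[ℝ] ℝ) 0 := by ext1; simp
  exact e

/-- Both partial maps of the multiplication at `(1, 1)` are the identity of `G`. -/
lemma mfderiv_mul_one_one [LieGroup (𝓡 d) ∞ G] (x y : EuclideanSpace ℝ (Fin d)) :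
    (mfderiv ((𝓡 d).prod (𝓡 d)) (𝓡 d) (fun p : G × G => p.1 * p.2) (1, 1) :
      EuclideanSpace ℝ (Fin d) × EuclideanSpace ℝ (Fin d) →L[ℝ] EuclideanSpace ℝ (Fin d)) (x, y) =
      x + y := by
  have hm : MDifferentiableAt ((𝓡 d).prod (𝓡 d)) (𝓡 d) (fun p : G × G => p.1 * p.2) (1, 1) :=
    (contMDiff_mul (𝓡 d) ∞).mdifferentiableAt (by simp)
  have h := mfderiv_prod_eq_add_apply hm (v := ((x, y) :
    EuclideanSpace ℝ (Fin d) × EuclideanSpace ℝ (Fin d)))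
  refine h.trans ?_
  have h1 := mfderiv_eq_id_of_eq (d := d) (f := fun z : G => z * 1) (fun g => mul_one g) 1
  have h2 := mfderiv_eq_id_of_eq (d := d) (f := fun z : G => 1 * z) (fun g => one_mul g) 1
  exact congrArg₂ (· + ·) (DFunLike.congr_fun h1 x) (DFunLike.congr_fun h2 y)

lemma HasVelocity.mul [LieGroup (𝓡 d) ∞ G] {c c' : ℝ → G} {x y : EuclideanSpace ℝ (Fin d)}
    (hc : HasVelocity c x) (hc' : HasVelocity c' y) : HasVelocity (fun t => c t * c' t) (x + y) := by
  refine ⟨by simp [hc.1, hc'.1], ?_⟩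
  -- The derivative is taken at `(c 0, c' 0)`, which equals `(1, 1)` only propositionally; naming it
  -- as a map of model spaces makes the rewriting possible.
  obtain ⟨A, hA, hAxy⟩ : ∃ A : EuclideanSpace ℝ (Fin d) × EuclideanSpace ℝ (Fin d) →L[ℝ]
      EuclideanSpace ℝ (Fin d), HasMFDerivAt ((𝓡 d).prod (𝓡 d)) (𝓡 d)
        (fun p : G × G => p.1 * p.2) (c 0, c' 0) A ∧ A (x, y) = x + y := by
    refine ⟨_, ?_, mfderiv_mul_one_one (G := G) x y⟩
    rw [hc.1, hc'.1]
    exact ((contMDiff_mul (𝓡 d) ∞).mdifferentiableAt (by simp)).hasMFDerivAt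
  have e : A ∘L (ContinuousLinearMap.smulRight (1 : ℝ →L[ℝ] ℝ) x).prod
      (ContinuousLinearMap.smulRight (1 : ℝ →L[ℝ] ℝ) y) =
      ContinuousLinearMap.smulRight (1 : ℝ →L[ℝ] ℝ) (x + y) := by
    ext1; simp [hAxy]
  exact (hA.comp (0 : ℝ) (hc.2.prodMk hc'.2)).congr_mfderiv e

/-- The preferred chart at the identity has derivative `id` there, so velocities can be read off in
the chart unchanged. -/
lemma HasVelocity.hasDerivAt_extChartAt [LieGroup (𝓡 d) ∞ G] {c : ℝ → G}
    {x : EuclideanSpace ℝ (Fin d)} (hc : HasVelocity c x) :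
    HasDerivAt (fun t => extChartAt (𝓡 d) (1 : G) (c t)) x 0 := by
  have : IsManifold (𝓡 d) 1 G := IsManifold.of_le (n := ∞) (by simp)
  have h := hc.hasDerivAt (f := extChartAt (𝓡 d) (1 : G)) (V := EuclideanSpace ℝ (Fin d))
    (mdifferentiableAt_extChartAt (mem_chart_source _ _))
  have e : derivOne 𝓘(ℝ, EuclideanSpace ℝ (Fin d)) (extChartAt (𝓡 d) (1 : G)) =
    ContinuousLinearMap.id ℝ _ := mfderiv_extChartAt_self
  rwa [e] at h

/-- `lieExp (t • x)` is the time-one value of a curve chosen separately for each `t`. Rescaling time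
and uniqueness of integral curves identify it with the single curve of `x` at time `t`. -/
lemma hasVelocity_lieExp [LieGroup (𝓡 d) ∞ G] [T2Space G] (x : GroupLieAlgebra (𝓡 d) G) :
    HasVelocity (fun t => lieExp (t • x)) x := by
  obtain ⟨h0, hγ⟩ := (exists_expCurve x).choose_spec
  set γ := (exists_expCurve x).choose
  have e : (fun t : ℝ => lieExp (t • x)) = γ := by
    ext t
    obtain ⟨h0', hγ'⟩ := (exists_expCurve (t • x)).choose_spec
    have h1 := hγ.comp_mul t
    rw [← mulInvariantVectorField_smul] at h1
    have hv' : ContMDiff (𝓡 d) (𝓡 d).tangent 1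
        (fun g : G => (⟨g, mulInvariantVectorField (t • x) g⟩ : TangentBundle (𝓡 d) G)) :=
      (contMDiff_mulInvariantVectorField (t • x)).of_le
        (by rw [minSmoothness_of_isRCLikeNormedField]; exact one_le_two)
    have h2 := isMIntegralCurve_Ioo_eq_of_contMDiff_boundaryless (t₀ := 0) hv' hγ' h1
      (by simp [h0, h0'])
    have h3 := congrFun h2 1
    simpa [lieExp] using h3
  rw [e]
  refine ⟨h0, ?_⟩
  have h : HasMFDerivAt 𝓘(ℝ, ℝ) (𝓡 d) γ 0 (ContinuousLinearMap.smulRight (1 : ℝ →L[ℝ] ℝ)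
    (mulInvariantVectorField x (γ 0) : EuclideanSpace ℝ (Fin d)) :
      ℝ →L[ℝ] EuclideanSpace ℝ (Fin d)) := hγ 0
  rwa [mulInvariantVectorField_of_eq_one x h0] at h

end Velocity

lemma contMDiff_comp_cons {d : ℕ} {G : Type*} [TopologicalSpace G]
    [ChartedSpace (EuclideanSpace ℝ (Fin d)) G] {V : Type*} [NormedAddCommGroup V]
    [NormedSpace ℝ V] {n : ℕ} {α : (Fin (n + 1) → G) → V}
    (hα : ContMDiff (powModel (𝓡 d) (n + 1)) 𝓘(ℝ, V) ∞ α) (g : G) :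
    ContMDiff (powModel (𝓡 d) n) 𝓘(ℝ, V) ∞ fun h => α (Fin.cons g h) := by
  refine hα.comp (contMDiff_power _ _ fun i => ?_)
  refine Fin.cases ?_ (fun i => ?_) i
  · exact contMDiff_const
  · exact contMDiff_power_apply _ i

/-! ### Mixed derivatives on powers of the group, in the chart at the identity -/

section Chart
variable {d : ℕ} {G : Type*} [TopologicalSpace G] [ChartedSpace (EuclideanSpace ℝ (Fin d)) G]
  [Group G] {V : Type*} [NormedAddCommGroup V] [NormedSpace ℝ V]

variable (d) in
/-- The function on the chart domain at the identity that represents a function on `Gⁿ`. -/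
def inChart {n : ℕ} (α : (Fin n → G) → V) (y : Fin n → EuclideanSpace ℝ (Fin d)) : V :=
  α fun i => (extChartAt (𝓡 d) (1 : G)).symm (y i)

variable (d G) in
/-- The identity in the chart. -/
def chartOne : EuclideanSpace ℝ (Fin d) := extChartAt (𝓡 d) (1 : G) 1

lemma contDiffAt_inChart {n : ℕ} {α : (Fin n → G) → V}
    (hα : ContMDiff (powModel (𝓡 d) n) 𝓘(ℝ, V) ∞ α) :
    ContDiffAt ℝ ∞ (inChart d α) fun _ => chartOne d G := by
  have h := (contMDiffAt_iff.1 (hα fun _ => 1)).2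
  have hr : range (powModel (𝓡 d) n) = univ := 
    eq_univ_of_forall fun y => ⟨fun i => y i, rfl⟩
  rw [hr, contDiffWithinAt_univ] at h
  exact h

lemma eventually_extChartAt_symm_apply :
    ∀ᶠ g in 𝓝 (1 : G), (extChartAt (𝓡 d) (1 : G)).symm (extChartAt (𝓡 d) (1 : G) g) = g := by
  filter_upwards [extChartAt_source_mem_nhds (I := 𝓡 d) (1 : G)] with g hg
  exact (extChartAt (𝓡 d) (1 : G)).left_inv hg

lemma HasVelocity.eventually_inChart_eq {n : ℕ} {c : Fin n → ℝ → G}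
    {x : Fin n → EuclideanSpace ℝ (Fin d)} (hc : ∀ i, HasVelocity (c i) (x i)) :
    ∀ᶠ t in 𝓝 (0 : Fin n → ℝ), (fun i => (extChartAt (𝓡 d) (1 : G)).symm
      (extChartAt (𝓡 d) (1 : G) (c i (t i)))) = fun i => c i (t i) := by
  have : ∀ i, ∀ᶠ t in 𝓝 (0 : Fin n → ℝ), (extChartAt (𝓡 d) (1 : G)).symm
      (extChartAt (𝓡 d) (1 : G) (c i (t i))) = c i (t i) := by
    intro i
    have h : Tendsto (fun t : Fin n → ℝ => c i (t i)) (𝓝 0) (𝓝 1) :=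
      (hc i).tendsto.comp ((continuous_apply i).tendsto (0 : Fin n → ℝ))
    exact h.eventually eventually_extChartAt_symm_apply
  filter_upwards [eventually_all.2 this] with t ht
  exact funext ht

lemma hasDerivAt_single {ι E : Type*} [Fintype ι] [DecidableEq ι] [NormedAddCommGroup E]
    [NormedSpace ℝ E] (i : ι) {κ : ℝ → E} {w : E} {t : ℝ} (hκ : HasDerivAt κ w t) :
    HasDerivAt (fun t => (Pi.single i (κ t) : ι → E)) (Pi.single i w) t :=
  (ContinuousLinearMap.single ℝ (fun _ : ι => E) i).hasFDerivAt.comp_hasDerivAt t hκ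

variable [LieGroup (𝓡 d) ∞ G]

/-- The mixed derivative of a smooth function on `Gⁿ` along curves through the identity only
depends on the velocities of the curves. -/
lemma mixedDeriv_comp_curves {n : ℕ} {α : (Fin n → G) → V}
    (hα : ContMDiff (powModel (𝓡 d) n) 𝓘(ℝ, V) ∞ α) {c : Fin n → ℝ → G}
    {x : Fin n → EuclideanSpace ℝ (Fin d)} (hc : ∀ i, HasVelocity (c i) (x i)) :
    mixedDeriv n (fun t => α fun i => c i (t i)) =
      iteratedFDeriv ℝ n (inChart d α) (fun _ => chartOne d G) fun i => Pi.single i (x i) := by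
  -- In the chart, the curve `c i` displaces the base point in slot `i` alone, so the product of the
  -- curves is the base point plus a sum of one-variable curves.
  rw [← mixedDeriv_comp_sum (κ := fun i t => Pi.single i
      (extChartAt (𝓡 d) (1 : G) (c i t) - chartOne d G))
    ((contDiffAt_inChart hα).of_le (by exact_mod_cast le_top))
    (fun i => by simp [(hc i).1, chartOne])
    (fun i => hasDerivAt_single i ((hc i).hasDerivAt_extChartAt.sub_const _))]
  refine mixedDeriv_congr ?_
  filter_upwards [HasVelocity.eventually_inChart_eq hc] with t ht
  rw [← ht, inChart]
  congr 1
  ext i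
  rw [Pi.add_apply, Finset.sum_apply, Finset.sum_pi_single]
  simp

/-- Mixed derivatives of a smooth function with respect to all but the first variable depend
smoothly on the first variable, near the identity. -/
lemma contMDiffAt_mixedDeriv_cons {n : ℕ} {α : (Fin (n + 1) → G) → V}
    (hα : ContMDiff (powModel (𝓡 d) (n + 1)) 𝓘(ℝ, V) ∞ α) {c : Fin n → ℝ → G}
    {x : Fin n → EuclideanSpace ℝ (Fin d)} (hc : ∀ i, HasVelocity (c i) (x i)) :
    ContMDiffAt (𝓡 d) 𝓘(ℝ, V) ∞
      (fun g => mixedDeriv n fun s => α (Fin.cons g fun i => c i (s i))) 1 := by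
  -- Freezing the first variable at `g` moves the base point to `q` of the chart image of `g`. The
  -- mixed derivative is then an iterated derivative at this point on fixed vectors, hence smooth in
  -- `g`.
  let q : EuclideanSpace ℝ (Fin d) → Fin (n + 1) → EuclideanSpace ℝ (Fin d) :=
    fun y => Fin.cons y fun _ => chartOne d G
  have hq : ContDiff ℝ ∞ q := by
    rw [contDiff_pi]
    intro i
    refine Fin.cases ?_ (fun i => ?_) i
    · exact contDiff_id
    · exact contDiff_const
  have hq1 : q (chartOne d G) = fun _ => chartOne d G := by
    ext1 i
    refine Fin.cases ?_ (fun i => ?_) i <;> rfl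
  have hβ : ContDiffAt ℝ ∞ (inChart d α) (q (chartOne d G)) := by
    rw [hq1]
    exact contDiffAt_inChart hα
  have hφ : ContMDiffAt (𝓡 d) 𝓘(ℝ, EuclideanSpace ℝ (Fin d)) ∞ (extChartAt (𝓡 d) (1 : G)) 1 :=
    contMDiffAt_extChartAt
  have hsm : ContDiffAt ℝ ∞ (fun y => iteratedFDeriv ℝ n (inChart d α) (q y)
      fun i : Fin n => Pi.single i.succ (x i)) (chartOne d G) := by
    have h1 : ContDiffAt ℝ ∞ (iteratedFDeriv ℝ n (inChart d α)) (q (chartOne d G)) :=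
      hβ.iteratedFDeriv_right (by exact_mod_cast le_top)
    exact (ContinuousMultilinearMap.apply ℝ (fun _ : Fin n => Fin (n + 1) → EuclideanSpace ℝ (Fin d))
      V (fun i : Fin n => Pi.single i.succ (x i))).contDiff.contDiffAt.comp _
        (h1.comp _ hq.contDiffAt)
  have hcomp := hsm.contMDiffAt.comp (1 : G) hφ
  refine hcomp.congr_of_eventuallyEq ?_
  have hqc : Tendsto (fun g : G => q (extChartAt (𝓡 d) (1 : G) g)) (𝓝 1)
      (𝓝 (q (chartOne d G))) := hq.continuous.continuousAt.tendsto.comp hφ.continuousAt.tendsto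
  have hβn : ContDiffAt ℝ n (inChart d α) (q (chartOne d G)) :=
    hβ.of_le (by exact_mod_cast le_top)
  filter_upwards [hqc.eventually (hβn.eventually (by simp)),
    eventually_extChartAt_symm_apply (d := d) (G := G)] with g hg hg1
  have hκ : ∀ i, HasDerivAt (fun t => (Pi.single i.succ (extChartAt (𝓡 d) (1 : G) (c i t) -
      chartOne d G) : Fin (n + 1) → EuclideanSpace ℝ (Fin d))) (Pi.single i.succ (x i)) 0 :=
    fun i => hasDerivAt_single i.succ ((hc i).hasDerivAt_extChartAt.sub_const (chartOne d G))
  rw [Function.comp_apply, ← mixedDeriv_comp_sum hg (fun i => by simp [(hc i).1, chartOne]) hκ]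
  refine mixedDeriv_congr ?_
  filter_upwards [HasVelocity.eventually_inChart_eq hc] with s hs
  rw [← hs, inChart]
  congr 1
  ext i
  rw [Pi.add_apply, Finset.sum_apply]
  refine Fin.cases ?_ (fun i => ?_) i
  · rw [Finset.sum_eq_zero fun i _ => Pi.single_eq_of_ne (Fin.succ_ne_zero i).symm _, add_zero]
    exact hg1.symm
  · simp [q, Pi.single_apply]

end Chart

/-! ### The Lie bracket as a commutator of derivatives along products of curves -/

section Commutator
variable {d : ℕ} {G : Type*} [TopologicalSpace G] [ChartedSpace (EuclideanSpace ℝ (Fin d)) G]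
  [Group G] {V : Type*} [NormedAddCommGroup V] [NormedSpace ℝ V]

lemma contDiffAt_inChart_one {f : G → V} (hf : ContMDiffAt (𝓡 d) 𝓘(ℝ, V) ∞ f 1) :
    ContDiffAt ℝ ∞ (fun p => f ((extChartAt (𝓡 d) (1 : G)).symm p)) (chartOne d G) := by
  have h := (contMDiffAt_iff.1 hf).2
  have hr : range (𝓡 d) = univ := by simp
  rw [hr, contDiffWithinAt_univ] at h
  exact h

lemma derivOne_eq_fderiv {f : G → V} (hf : MDifferentiableAt (𝓡 d) 𝓘(ℝ, V) f 1) :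
    derivOne 𝓘(ℝ, V) f =
      fderiv ℝ (fun p => f ((extChartAt (𝓡 d) (1 : G)).symm p)) (chartOne d G) := by
  have h := hf.mfderiv
  have hr : range (𝓡 d) = univ := by simp
  rw [hr, fderivWithin_univ] at h
  exact h

variable [LieGroup (𝓡 d) ∞ G]

/-- The left-invariant vector field generated by `x`, in the chart at the identity. -/
def invariantFieldInChart (x : GroupLieAlgebra (𝓡 d) G) :
    EuclideanSpace ℝ (Fin d) → EuclideanSpace ℝ (Fin d) :=
  VectorField.mpullbackWithin 𝓘(ℝ, EuclideanSpace ℝ (Fin d)) (𝓡 d)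
    (extChartAt (𝓡 d) (1 : G)).symm (mulInvariantVectorField x) (range (𝓡 d))

lemma isManifold_one : IsManifold (𝓡 d) 1 G := IsManifold.of_le (n := ∞) (by simp)
lemma isManifold_two : IsManifold (𝓡 d) 2 G :=
  IsManifold.of_le (n := ∞) (WithTop.coe_le_coe.2 le_top)

lemma differentiableAt_invariantFieldInChart (x : GroupLieAlgebra (𝓡 d) G) :
    DifferentiableAt ℝ (invariantFieldInChart x) (chartOne d G) := by
  have := isManifold_two (d := d) (G := G)
  have h : DifferentiableWithinAt ℝ (invariantFieldInChart x)
      ((extChartAt (𝓡 d) (1 : G)).symm ⁻¹' univ ∩ range (𝓡 d)) (chartOne d G) :=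
    (mdifferentiableAt_mulInvariantVectorField x (g := (1 : G))).mdifferentiableWithinAt (s := univ)
    |>.differentiableWithinAt_mpullbackWithin_vectorField
  have hu : (extChartAt (𝓡 d) (1 : G)).symm ⁻¹' univ ∩ range (𝓡 d) = univ := by simp
  rwa [hu, differentiableWithinAt_univ] at h

lemma invariantFieldInChart_chartOne (x : GroupLieAlgebra (𝓡 d) G) :
    invariantFieldInChart x (chartOne d G) = (x : EuclideanSpace ℝ (Fin d)) := by
  have := isManifold_one (d := d) (G := G)
  have h1 := mulInvariantVectorField_of_eq_one x (extChartAt_to_inv (I := 𝓡 d) (1 : G))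
  have h2 := mfderivWithin_extChartAt_symm_inverse_apply (I := 𝓡 d) (x := (1 : G)) x
  refine Eq.trans ?_ h2
  exact congrArg (mfderivWithin 𝓘(ℝ, EuclideanSpace ℝ (Fin d)) (𝓡 d)
    (extChartAt (𝓡 d) (1 : G)).symm (range (𝓡 d)) (extChartAt (𝓡 d) (1 : G) 1) :
      EuclideanSpace ℝ (Fin d) →L[ℝ] EuclideanSpace ℝ (Fin d)).inverse h1

/-- The bracket is by definition the bracket in the chart pulled back by the derivative of the
chart, which is the identity at the base point. -/
lemma bracket_eq_lieBracket (x y : GroupLieAlgebra (𝓡 d) G) :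
    (⁅x, y⁆ : GroupLieAlgebra (𝓡 d) G) = (VectorField.lieBracket ℝ (invariantFieldInChart x)
      (invariantFieldInChart y) (chartOne d G) : EuclideanSpace ℝ (Fin d)) := by
  have := isManifold_one (d := d) (G := G)
  have hu : (extChartAt (𝓡 d) (1 : G)).symm ⁻¹' univ ∩ range (𝓡 d) = univ := by simp
  obtain ⟨A, hA, h⟩ : ∃ A : EuclideanSpace ℝ (Fin d) →L[ℝ] EuclideanSpace ℝ (Fin d),
      A = ContinuousLinearMap.id ℝ _ ∧ (⁅x, y⁆ : GroupLieAlgebra (𝓡 d) G) =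
        A.inverse (VectorField.lieBracketWithin ℝ (invariantFieldInChart x)
          (invariantFieldInChart y) ((extChartAt (𝓡 d) (1 : G)).symm ⁻¹' univ ∩ range (𝓡 d))
          (chartOne d G)) :=
    ⟨mfderiv (𝓡 d) 𝓘(ℝ, EuclideanSpace ℝ (Fin d)) (extChartAt (𝓡 d) (1 : G)) 1,
      mfderiv_extChartAt_self, rfl⟩
  rw [h, hA, ContinuousLinearMap.inverse_id, hu, VectorField.lieBracketWithin_univ]
  rfl

lemma eventually_mdifferentiableAt {f : G → V} (hf : ContMDiffAt (𝓡 d) 𝓘(ℝ, V) ∞ f 1) :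
    ∀ᶠ g in 𝓝 (1 : G), MDifferentiableAt (𝓡 d) 𝓘(ℝ, V) f g := by
  have := isManifold_one (d := d) (G := G)
  have h1 : ContMDiffAt (𝓡 d) 𝓘(ℝ, V) 1 f 1 := hf.of_le (by simp)
  filter_upwards [(contMDiffAt_iff_contMDiffAt_nhds (by simp)).1 h1] with g hg
  exact hg.mdifferentiableAt (by simp)

/-- With `A` the derivative of the inverse chart, the chain rule turns `df` into `df ∘ A`, and the
field read in the chart carries the cancelling factor `A⁻¹`. -/
lemma fderiv_invariantFieldInChart {f : G → V} (y : GroupLieAlgebra (𝓡 d) G) {g : G}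
    (hf : MDifferentiableAt (𝓡 d) 𝓘(ℝ, V) f g) (hg : g ∈ (extChartAt (𝓡 d) (1 : G)).source) :
    fderiv ℝ (fun p => f ((extChartAt (𝓡 d) (1 : G)).symm p)) (extChartAt (𝓡 d) (1 : G) g)
      (invariantFieldInChart y (extChartAt (𝓡 d) (1 : G) g)) =
      (mfderiv (𝓡 d) 𝓘(ℝ, V) f g : EuclideanSpace ℝ (Fin d) →L[ℝ] V)
        (mulInvariantVectorField y g) := by
  have := isManifold_one (d := d) (G := G)
  have hp : extChartAt (𝓡 d) (1 : G) g ∈ (extChartAt (𝓡 d) (1 : G)).target :=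
    (extChartAt (𝓡 d) (1 : G)).map_source hg
  obtain ⟨p, hpg⟩ : ∃ p, p = extChartAt (𝓡 d) (1 : G) g := ⟨_, rfl⟩
  have hgp : (extChartAt (𝓡 d) (1 : G)).symm p = g := by
    rw [hpg]; exact (extChartAt (𝓡 d) (1 : G)).left_inv hg
  rw [← hpg] at hp ⊢
  subst hgp
  have hs := mdifferentiableWithinAt_extChartAt_symm hp
  obtain ⟨A, B, hA, hAi, hB, hAy⟩ : ∃ (A : EuclideanSpace ℝ (Fin d) →L[ℝ] EuclideanSpace ℝ (Fin d))
      (B : EuclideanSpace ℝ (Fin d) →L[ℝ] V),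
      HasMFDerivWithinAt 𝓘(ℝ, EuclideanSpace ℝ (Fin d)) (𝓡 d) (extChartAt (𝓡 d) (1 : G)).symm
        (range (𝓡 d)) p A ∧ A.IsInvertible ∧
      B = mfderiv (𝓡 d) 𝓘(ℝ, V) f ((extChartAt (𝓡 d) (1 : G)).symm p) ∧
      invariantFieldInChart y p =
        A.inverse (mulInvariantVectorField y ((extChartAt (𝓡 d) (1 : G)).symm p)) :=
    ⟨_, _, hs.hasMFDerivWithinAt, isInvertible_mfderivWithin_extChartAt_symm hp, rfl, rfl⟩
  have hr : range (𝓡 d) = univ := by simp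
  rw [hr] at hA
  have hf' : HasMFDerivAt (𝓡 d) 𝓘(ℝ, V) f ((extChartAt (𝓡 d) (1 : G)).symm p) B := by
    rw [hB]
    exact hf.hasMFDerivAt
  have h1 : HasFDerivAt (fun p => f ((extChartAt (𝓡 d) (1 : G)).symm p)) (B ∘L A) p :=
    (hf'.comp p (hasMFDerivWithinAt_univ.1 hA)).hasFDerivAt
  rw [h1.fderiv, hAy, ← hB, ContinuousLinearMap.comp_apply]
  exact congrArg B (hAi.self_apply_inverse _)

/-- Left translation by `g` carries the velocity `y` at the identity to the value at `g` of the
left-invariant field of `y`. -/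
lemma HasVelocity.hasDerivAt_mul_left {f : G → V} {c : ℝ → G} {y : GroupLieAlgebra (𝓡 d) G}
    (hc : HasVelocity c y) {g : G} (hf : MDifferentiableAt (𝓡 d) 𝓘(ℝ, V) f g) :
    HasDerivAt (fun t => f (g * c t)) ((mfderiv (𝓡 d) 𝓘(ℝ, V) f g :
      EuclideanSpace ℝ (Fin d) →L[ℝ] V) (mulInvariantVectorField y g)) 0 := by
  have hf' : MDifferentiableAt (𝓡 d) 𝓘(ℝ, V) f (g * 1) := by rwa [mul_one]
  have h := hc.hasDerivAt (f := fun h => f (g * h))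
    (hf'.comp (1 : G) (mdiff_mul_left (d := d) g 1))
  have e : derivOne 𝓘(ℝ, V) (fun h => f (g * h)) = (mfderiv (𝓡 d) 𝓘(ℝ, V) f g :
      EuclideanSpace ℝ (Fin d) →L[ℝ] V) ∘L (mfderiv (𝓡 d) (𝓡 d) (g * ·) 1 :
      EuclideanSpace ℝ (Fin d) →L[ℝ] EuclideanSpace ℝ (Fin d)) := by
    have h1 : HasMFDerivAt (𝓡 d) 𝓘(ℝ, V) f (g * 1) (mfderiv (𝓡 d) 𝓘(ℝ, V) f g :
      EuclideanSpace ℝ (Fin d) →L[ℝ] V) := by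
      rw [mul_one]
      exact hf.hasMFDerivAt
    exact (h1.comp (1 : G) (mdiff_mul_left (d := d) g 1).hasMFDerivAt).mfderiv
  rw [e] at h
  exact h

/-- Let `X, Y` be the left-invariant fields of `x, y`. The inner derivative is `(Yf)(c s)`, so the
outer one is `X(Yf)` at the identity, written in the chart. -/
lemma deriv_deriv_mul {f : G → V} (hf : ContMDiffAt (𝓡 d) 𝓘(ℝ, V) ∞ f 1) {c c' : ℝ → G}
    {x y : GroupLieAlgebra (𝓡 d) G} (hc : HasVelocity c x) (hc' : HasVelocity c' y) :
    deriv (fun s => deriv (fun t => f (c s * c' t)) 0) 0 =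
      fderiv ℝ (fun p => fderiv ℝ (fun p => f ((extChartAt (𝓡 d) (1 : G)).symm p)) p
        (invariantFieldInChart y p)) (chartOne d G) (invariantFieldInChart x (chartOne d G)) := by
  set f₁ : EuclideanSpace ℝ (Fin d) → V := fun p => f ((extChartAt (𝓡 d) (1 : G)).symm p)
  have hf₁ : ContDiffAt ℝ ∞ f₁ (chartOne d G) := contDiffAt_inChart_one hf
  have hev : ∀ᶠ s in 𝓝 (0 : ℝ), deriv (fun t => f (c s * c' t)) 0 =
      fderiv ℝ f₁ (extChartAt (𝓡 d) (1 : G) (c s))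
        (invariantFieldInChart y (extChartAt (𝓡 d) (1 : G) (c s))) := by
    filter_upwards [hc.tendsto.eventually (eventually_mdifferentiableAt hf),
      hc.tendsto.eventually (extChartAt_source_mem_nhds (I := 𝓡 d) (1 : G))] with s hs hs'
    rw [(hc'.hasDerivAt_mul_left hs).deriv, fderiv_invariantFieldInChart y hs hs']
  rw [EventuallyEq.deriv_eq hev, invariantFieldInChart_chartOne]
  have hd : DifferentiableAt ℝ (fun p => fderiv ℝ f₁ p (invariantFieldInChart y p))
      (extChartAt (𝓡 d) (1 : G) (c 0)) := by
    rw [hc.1]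
    refine DifferentiableAt.clm_apply ?_ (differentiableAt_invariantFieldInChart y)
    exact (hf₁.fderiv_right (m := 1) (WithTop.coe_le_coe.2 le_top)).differentiableAt (by simp)
  have h := (hd.hasFDerivAt.comp_hasDerivAt (0 : ℝ) hc.hasDerivAt_extChartAt).deriv
  rw [hc.1] at h
  exact h

/-- The bracket of the Lie algebra as a commutator of derivatives. -/
lemma deriv_deriv_mul_sub {f : G → V} (hf : ContMDiffAt (𝓡 d) 𝓘(ℝ, V) ∞ f 1) {c c' : ℝ → G}
    {x y : GroupLieAlgebra (𝓡 d) G} (hc : HasVelocity c x) (hc' : HasVelocity c' y) :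
    deriv (fun s => deriv (fun t => f (c s * c' t)) 0) 0 -
      deriv (fun s => deriv (fun t => f (c' s * c t)) 0) 0 =
      derivOne 𝓘(ℝ, V) f (⁅x, y⁆ : GroupLieAlgebra (𝓡 d) G) := by
  have h := VectorField.fderiv_apply_lieBracket (contDiffAt_inChart_one hf)
    (by rw [minSmoothness_of_isRCLikeNormedField]; exact WithTop.coe_le_coe.2 le_top)
    (differentiableAt_invariantFieldInChart y) (differentiableAt_invariantFieldInChart x)
  rw [deriv_deriv_mul hf hc hc', deriv_deriv_mul hf hc' hc, ← h, bracket_eq_lieBracket,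
    derivOne_eq_fderiv (hf.mdifferentiableAt (by simp))]

end Commutator

/-! ### Jets of group cochains along one-parameter subgroups -/

section ExpJet
variable {d : ℕ} {G : Type*} [TopologicalSpace G] [ChartedSpace (EuclideanSpace ℝ (Fin d)) G]
  [Group G] [LieGroup (𝓡 d) ∞ G] [T2Space G] {V : Type*} [NormedAddCommGroup V] [NormedSpace ℝ V]

/-- The mixed derivative at the identity of a function on `Gⁿ` along one-parameter subgroups. -/
def expJet {n : ℕ} (α : (Fin n → G) → V) (u : Fin n → GroupLieAlgebra (𝓡 d) G) : V :=
  mixedDeriv n fun t => α fun i => lieExp (t i • u i)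

lemma vanEstFun_eq_altSum {n : ℕ} (α : (Fin n → G) → V) (x : Fin n → GroupLieAlgebra (𝓡 d) G) :
    vanEstFun α x = altSum (expJet α) x := rfl

lemma mixedDeriv_eq_expJet {n : ℕ} {α : (Fin n → G) → V}
    (hα : ContMDiff (powModel (𝓡 d) n) 𝓘(ℝ, V) ∞ α) {c : Fin n → ℝ → G}
    {x : Fin n → GroupLieAlgebra (𝓡 d) G} (hc : ∀ i, HasVelocity (c i) (x i)) :
    mixedDeriv n (fun t => α fun i => c i (t i)) = expJet α x :=
  (mixedDeriv_comp_curves hα hc).trans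
    (mixedDeriv_comp_curves hα fun i => hasVelocity_lieExp (x i)).symm

lemma expJet_eq_iteratedFDeriv {n : ℕ} {α : (Fin n → G) → V}
    (hα : ContMDiff (powModel (𝓡 d) n) 𝓘(ℝ, V) ∞ α) (x : Fin n → GroupLieAlgebra (𝓡 d) G) :
    expJet α x = iteratedFDeriv ℝ n (inChart d α) (fun _ => chartOne d G)
      fun i => Pi.single i (x i : EuclideanSpace ℝ (Fin d)) :=
  mixedDeriv_comp_curves hα fun i => hasVelocity_lieExp (x i)

/-- `expJet` as a multilinear map. -/
def expJetMultilinear {n : ℕ} (α : (Fin n → G) → V) :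
    MultilinearMap ℝ (fun _ : Fin n => GroupLieAlgebra (𝓡 d) G) V :=
  (iteratedFDeriv ℝ n (inChart d α) fun _ => chartOne d G).toMultilinearMap.compLinearMap
    fun i => (LinearMap.single ℝ (fun _ : Fin n => EuclideanSpace ℝ (Fin d)) i :
      GroupLieAlgebra (𝓡 d) G →ₗ[ℝ] Fin n → EuclideanSpace ℝ (Fin d))

lemma expJetMultilinear_apply {n : ℕ} {α : (Fin n → G) → V}
    (hα : ContMDiff (powModel (𝓡 d) n) 𝓘(ℝ, V) ∞ α) (x : Fin n → GroupLieAlgebra (𝓡 d) G) :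
    expJetMultilinear α x = expJet α x :=
  (expJet_eq_iteratedFDeriv hα x).symm

lemma expJet_add {n : ℕ} {α β : (Fin n → G) → V}
    (hα : ContMDiff (powModel (𝓡 d) n) 𝓘(ℝ, V) ∞ α)
    (hβ : ContMDiff (powModel (𝓡 d) n) 𝓘(ℝ, V) ∞ β) (x : Fin n → GroupLieAlgebra (𝓡 d) G) :
    expJet (fun g => α g + β g) x = expJet α x + expJet β x := by
  have ha := (contDiffAt_inChart hα).of_le (m := n) (by exact_mod_cast le_top)
  have hb := (contDiffAt_inChart hβ).of_le (m := n) (by exact_mod_cast le_top)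
  rw [expJet_eq_iteratedFDeriv hα, expJet_eq_iteratedFDeriv hβ,
    expJet_eq_iteratedFDeriv (α := fun g => α g + β g) (hα.add hβ)]
  have h := iteratedFDeriv_add_apply ha hb
  exact DFunLike.congr_fun h _

lemma expJet_clm {n : ℕ} {W : Type*} [NormedAddCommGroup W] [NormedSpace ℝ W] (A : V →L[ℝ] W)
    {α : (Fin n → G) → V} (hα : ContMDiff (powModel (𝓡 d) n) 𝓘(ℝ, V) ∞ α)
    (x : Fin n → GroupLieAlgebra (𝓡 d) G) : expJet (fun g => A (α g)) x = A (expJet α x) := by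
  have ha := contDiffAt_inChart hα
  rw [expJet_eq_iteratedFDeriv hα, expJet_eq_iteratedFDeriv (α := fun g => A (α g)) (A.contMDiff.comp hα)]
  have h := A.iteratedFDeriv_comp_left ha (i := n) (by exact_mod_cast le_top)
  exact DFunLike.congr_fun h _

lemma expJet_smul {n : ℕ} (a : ℝ) {α : (Fin n → G) → V}
    (hα : ContMDiff (powModel (𝓡 d) n) 𝓘(ℝ, V) ∞ α) (x : Fin n → GroupLieAlgebra (𝓡 d) G) :
    expJet (fun g => a • α g) x = a • expJet α x :=
  expJet_clm (a • ContinuousLinearMap.id ℝ V) hα x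

lemma expJet_sub {n : ℕ} {α β : (Fin n → G) → V}
    (hα : ContMDiff (powModel (𝓡 d) n) 𝓘(ℝ, V) ∞ α)
    (hβ : ContMDiff (powModel (𝓡 d) n) 𝓘(ℝ, V) ∞ β) (x : Fin n → GroupLieAlgebra (𝓡 d) G) :
    expJet (fun g => α g - β g) x = expJet α x - expJet β x := by
  have h := expJet_add hα (contMDiff_constSmul (-1) hβ) x
  rw [expJet_smul _ hβ] at h
  simpa [sub_eq_add_neg] using h

lemma expJet_zero {n : ℕ} (x : Fin n → GroupLieAlgebra (𝓡 d) G) :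
    expJet (fun _ => (0 : V)) x = 0 := by
  have h := expJet_smul (V := V) (0 : ℝ) (n := n) (α := fun _ : Fin n → G => 0) contMDiff_const x
  simpa using h

lemma expJet_sum {n : ℕ} {ι : Type*} (s : Finset ι) {α : ι → (Fin n → G) → V}
    (hα : ∀ k, ContMDiff (powModel (𝓡 d) n) 𝓘(ℝ, V) ∞ (α k))
    (x : Fin n → GroupLieAlgebra (𝓡 d) G) :
    expJet (fun g => ∑ k ∈ s, α k g) x = ∑ k ∈ s, expJet (α k) x := by
  classical
  induction s using Finset.induction_on with
  | empty => simpa using expJet_zero x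
  | insert k s hk ih =>
    simp only [Finset.sum_insert hk]
    rw [expJet_add (hα k) (contMDiff_finsetSum fun k _ => hα k), ih]

lemma expJet_castSucc {n : ℕ} (α : (Fin n → G) → V) (u : Fin (n + 1) → GroupLieAlgebra (𝓡 d) G) :
    expJet (fun g : Fin (n + 1) → G => α fun i => g i.castSucc) u = 0 :=
  mixedDeriv_castSucc n fun t => α fun i => lieExp (t i • u i.castSucc)

lemma expJet_succ {n : ℕ} (α : (Fin (n + 1) → G) → V)
    (u : Fin (n + 1) → GroupLieAlgebra (𝓡 d) G) :
    expJet α u = deriv (fun t : ℝ => expJet (fun g => α (Fin.cons (lieExp (t • u 0)) g))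
      fun i => u i.succ) 0 := by
  rw [expJet, mixedDeriv_succ]
  congr 1
  ext t
  rw [expJet]
  congr 1
  ext s
  congr 1
  ext i
  refine Fin.cases ?_ (fun i => ?_) i <;> simp

lemma contMDiffAt_expJet_cons {n : ℕ} {α : (Fin (n + 1) → G) → V}
    (hα : ContMDiff (powModel (𝓡 d) (n + 1)) 𝓘(ℝ, V) ∞ α) (u : Fin n → GroupLieAlgebra (𝓡 d) G) :
    ContMDiffAt (𝓡 d) 𝓘(ℝ, V) ∞ (fun g => expJet (fun h => α (Fin.cons g h)) u) 1 :=
  contMDiffAt_mixedDeriv_cons hα fun i => hasVelocity_lieExp (u i)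

/-- The inner derivatives pass through the fixed linear map `Θ(g₀)`; the outermost one sees only
`Θ`. -/
lemma expJet_rep (Θ : SmoothRep d G V) {n : ℕ} {α : (Fin n → G) → V}
    (hα : ContMDiff (powModel (𝓡 d) n) 𝓘(ℝ, V) ∞ α)
    (u : Fin (n + 1) → GroupLieAlgebra (𝓡 d) G) :
    expJet (fun g : Fin (n + 1) → G => Θ (g 0) (α fun i => g i.succ)) u =
      Θ.lie (u 0) (expJet α fun i => u i.succ) := by
  rw [expJet_succ]
  simp only [Fin.cons_zero, Fin.cons_succ, expJet_clm _ hα]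
  have h := (hasVelocity_lieExp (u 0)).hasDerivAt (f := fun g => Θ g)
    (Θ.smooth.mdifferentiableAt (by simp))
  exact (h.clm_apply (hasDerivAt_const (0 : ℝ) (expJet α fun i => u i.succ))).deriv.trans (by
    rw [map_zero, add_zero]
    rfl)

lemma contractNth_zero_cons_cons {X : Type*} (op : X → X → X) {m : ℕ} (a b : X) (r : Fin m → X) :
    Fin.contractNth (0 : Fin (m + 2)) op (Fin.cons a (Fin.cons b r) : Fin (m + 2) → X) =
      Fin.cons (op a b) r := by
  ext i
  refine Fin.cases ?_ (fun i => ?_) i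
  · rw [Fin.contractNth_apply_of_eq _ _ _ _ rfl]
    rfl
  · rw [Fin.contractNth_apply_of_gt _ _ _ _ (Nat.succ_pos _)]
    rfl

lemma contractNth_succ_cons {X : Type*} (op : X → X → X) {m : ℕ} (k : Fin (m + 1)) (a : X)
    (g : Fin (m + 1) → X) :
    Fin.contractNth k.succ op (Fin.cons a g : Fin (m + 2) → X) =
      Fin.cons a (Fin.contractNth k op g) := by
  ext i
  refine Fin.cases ?_ (fun i => ?_) i
  · rw [Fin.contractNth_apply_of_lt _ _ _ _ (Nat.succ_pos _)]
    rfl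
  · rw [Fin.cons_succ]
    rcases lt_trichotomy (i : ℕ) k with h | h | h
    · rw [Fin.contractNth_apply_of_lt _ _ _ _ h,
        Fin.contractNth_apply_of_lt _ _ _ _ (by simpa using h)]
      rfl
    · rw [Fin.contractNth_apply_of_eq _ _ _ _ h,
        Fin.contractNth_apply_of_eq _ _ _ _ (by simpa using h)]
      rfl
    · rw [Fin.contractNth_apply_of_gt _ _ _ _ h,
        Fin.contractNth_apply_of_gt _ _ _ _ (by simpa using h)]
      rfl

/-- Index bookkeeping for the induction that freezes the first variable; `contractNth_succ_cons` is
its counterpart on the group. -/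
lemma insertNth_succ_removeNth_removeNth {X : Type*} {m : ℕ} (k : Fin (m + 1)) (z : X)
    (u : Fin (m + 3) → X) :
    k.succ.insertNth z (k.succ.removeNth (k.castSucc.succ.removeNth u)) = (Fin.cons (u 0)
      (k.insertNth z (k.removeNth (k.castSucc.removeNth fun i => u i.succ))) : Fin (m + 2) → X) := by
  rw [Fin.insertNth_eq_iff]
  refine ⟨by simp, ?_⟩
  ext i
  refine Fin.cases ?_ (fun i => ?_) i <;> simp [Fin.removeNth]

lemma expJet_contractNth_zero {m : ℕ} (α : (Fin (m + 1) → G) → V)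
    (u : Fin (m + 2) → GroupLieAlgebra (𝓡 d) G) :
    expJet (fun g : Fin (m + 2) → G => α (Fin.contractNth 0 (· * ·) g)) u =
      deriv (fun s : ℝ => deriv (fun t : ℝ => expJet (fun h => α (Fin.cons
        (lieExp (s • u 0) * lieExp (t • u 1)) h)) fun i => u i.succ.succ) 0) 0 := by
  rw [expJet_succ]
  congr 1
  ext s
  rw [expJet_succ]
  simp only [contractNth_zero_cons_cons]
  rfl

/-- The failure of the mixed derivative of `α(g₀ g₁, g₂, …)` to be symmetric in the first two
entries. -/
lemma expJet_contractNth_zero_sub_swap {m : ℕ} {α : (Fin (m + 1) → G) → V}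
    (hα : ContMDiff (powModel (𝓡 d) (m + 1)) 𝓘(ℝ, V) ∞ α)
    (u : Fin (m + 2) → GroupLieAlgebra (𝓡 d) G) :
    expJet (fun g : Fin (m + 2) → G => α (Fin.contractNth 0 (· * ·) g)) u -
      expJet (fun g : Fin (m + 2) → G => α (Fin.contractNth 0 (· * ·) g))
        (fun l => u (Equiv.swap 0 1 l)) =
      expJet α (Fin.cons ⁅u 0, u 1⁆ fun i => u i.succ.succ) := by
  have hs : ∀ i : Fin m, Equiv.swap (0 : Fin (m + 2)) 1 i.succ.succ = i.succ.succ := fun i =>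
    Equiv.swap_apply_of_ne_of_ne (Fin.succ_ne_zero _)
      (fun h => Fin.succ_ne_zero i (Fin.succ_injective _ (h.trans Fin.succ_zero_eq_one.symm)))
  have hf := contMDiffAt_expJet_cons hα fun i => u i.succ.succ
  rw [expJet_contractNth_zero, expJet_contractNth_zero]
  simp only [hs, Equiv.swap_apply_left, Equiv.swap_apply_right]
  -- The commutator formula is applied to the function of `g` obtained by taking the jet of `α(g,
  -- ·)` in the remaining variables, which is smooth near the identity.
  rw [deriv_deriv_mul_sub hf (hasVelocity_lieExp (u 0)) (hasVelocity_lieExp (u 1)),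
    expJet_succ]
  simp only [Fin.cons_zero, Fin.cons_succ]
  exact ((hasVelocity_lieExp ⁅u 0, u 1⁆).hasDerivAt (hf.mdifferentiableAt (by simp))).deriv.symm

/-- The failure of the mixed derivative of `α(…, gₖ gₖ₊₁, …)` to be symmetric in the entries `k`
and `k + 1`. -/
lemma expJet_contractNth_sub_swap : ∀ {m : ℕ} {α : (Fin (m + 1) → G) → V}
    (_ : ContMDiff (powModel (𝓡 d) (m + 1)) 𝓘(ℝ, V) ∞ α) (k : Fin (m + 1))
    (u : Fin (m + 2) → GroupLieAlgebra (𝓡 d) G),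
    expJet (fun g : Fin (m + 2) → G => α (Fin.contractNth k.castSucc (· * ·) g)) u -
      expJet (fun g : Fin (m + 2) → G => α (Fin.contractNth k.castSucc (· * ·) g))
        (fun l => u (Equiv.swap k.castSucc k.succ l)) =
      expJet α (k.insertNth ⁅u k.castSucc, u k.succ⁆ (k.removeNth (k.castSucc.removeNth u))) := by
  intro m α hα k u
  rcases Fin.eq_zero_or_eq_succ k with rfl | ⟨k, rfl⟩
  · rw [Fin.insertNth_zero']
    exact expJet_contractNth_zero_sub_swap hα u
  · obtain ⟨m, rfl⟩ : ∃ m', m = m' + 1 := ⟨m - 1, by have := k.2; omega⟩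
    rw [← Fin.succ_castSucc, insertNth_succ_removeNth_removeNth]
    have hsw : ∀ l : Fin (m + 2), Equiv.swap k.castSucc.succ k.succ.succ l.succ =
        (Equiv.swap k.castSucc k.succ l).succ := fun l =>
      ((Fin.succ_injective _).map_swap _ _ _).symm
    have hsw0 : Equiv.swap k.castSucc.succ k.succ.succ 0 = 0 :=
      Equiv.swap_apply_of_ne_of_ne (Fin.succ_ne_zero _).symm (Fin.succ_ne_zero _).symm
    have hP : ∀ v : Fin (m + 2) → GroupLieAlgebra (𝓡 d) G, DifferentiableAt ℝ (fun t : ℝ =>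
        expJet (fun g => α (Fin.cons (lieExp (t • u 0)) (Fin.contractNth k.castSucc (· * ·) g))) v)
        0 := by
      intro v
      have hβ : ContMDiff (powModel (𝓡 d) (m + 3)) 𝓘(ℝ, V) ∞ fun g : Fin (m + 3) → G =>
          α (Fin.contractNth k.castSucc.succ (· * ·) g) := hα.comp (contMDiff_contractNth _)
      have h := (contMDiffAt_expJet_cons hβ v).mdifferentiableAt (by simp)
      simp only [contractNth_succ_cons] at h
      exact ((hasVelocity_lieExp (u 0)).hasDerivAt h).differentiableAt
    rw [expJet_succ, expJet_succ _ (fun l => u (Equiv.swap k.castSucc.succ k.succ.succ l)),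
      expJet_succ α]
    simp only [hsw, hsw0, contractNth_succ_cons, Fin.cons_zero, Fin.cons_succ]
    -- The swap leaves slot `0` alone, so the difference goes inside the outermost derivative. For
    -- each `t` the induction hypothesis applies to `α` with its first argument frozen.
    rw [← deriv_fun_sub (hP _) (hP _)]
    congr 1
    ext t
    exact expJet_contractNth_sub_swap (contMDiff_comp_cons hα _) k fun i => u i.succ

end ExpJet

/-! ### The term `p` of the group operator and restriction to the graph of `D` -/

section GraphRestriction
variable {d : ℕ} {G : Type*} [TopologicalSpace G] [ChartedSpace (EuclideanSpace ℝ (Fin d)) G]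
  [Group G] [LieGroup (𝓡 d) ∞ G] {V : Type*} [NormedAddCommGroup V] [NormedSpace ℝ V]
  {D : DifferenceOperator d G}

/-- The cochain `g ↦ η(D(g), g)`. -/
def restrictGraph (D : DifferenceOperator d G) (η : GroupCochain d G V 2) :
    GroupCochain d G V 1 :=
  ⟨fun g => η.1 ![D (g 0), g 0], by
    have p0 := contMDiff_power_apply (G := G) (𝓡 d) (0 : Fin 1)
    refine ⟨η.2.1.comp (contMDiff_power _ _ fun i => ?_), ?_⟩
    · fin_cases i
      exacts [D.smooth.comp p0, p0]
    · rintro g ⟨i, hi⟩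
      rw [Subsingleton.elim i 0] at hi
      exact η.2.2 _ ⟨1, hi⟩⟩

/-- At `(D(g), g)` the coboundary of `α` is `Θ(D(g))α(g) - α(D(g)g) + α(D(g))`. -/
lemma pKFun_one (ρ : DifferenceRep V D) (α : GroupCochain d G V 1) :
    pKFun ρ 1 α.1 = (-restrictGraph D (groupCob ρ.Θ 1 α)).1 := by
  ext g
  change _ = -groupCobFun ρ.Θ α.1 ![D (g 0), g 0]
  have e : ∀ h : Fin 1 → G, h = ![h 0] := fun h => by
    ext i
    rw [Subsingleton.elim i 0]
    rfl
  rw [groupCobFun, Fin.sum_univ_one, e (fun i : Fin 1 => (![D (g 0), g 0] : Fin 2 → G) i.succ),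
    e (fun i : Fin 1 => (![D (g 0), g 0] : Fin 2 → G) i.castSucc), e (Fin.contractNth _ _ _)]
  simp [pKFun, Fin.contractNth]
  abel

lemma pKFun_two (ρ : DifferenceRep V D) (α : GroupCochain d G V 2) :
    pKFun ρ 2 α.1 = (groupCob (ρ.Θ.twist D) 1 (restrictGraph D α)).1 := by
  ext g
  change _ = groupCobFun (ρ.Θ.twist D) (restrictGraph D α).1 g
  rw [groupCobFun, Fin.sum_univ_one]
  simp [pKFun, restrictGraph, Fin.contractNth, SmoothRep.twist]
  abel

/-- A normalized cochain of degree two has vanishing differential at the identity. -/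
lemma hasDerivAt_normalized_two (η : GroupCochain d G V 2) {c c' : ℝ → G}
    {x y : EuclideanSpace ℝ (Fin d)} (hc : HasVelocity c x) (hc' : HasVelocity c' y) :
    HasDerivAt (fun t => η.1 ![c t, c' t]) 0 0 := by
  have key : ∀ {b b' : ℝ → G} {v w : EuclideanSpace ℝ (Fin d)}, HasVelocity b v →
      HasVelocity b' w → HasDerivAt (fun t => η.1 ![b t, b' t])
        (fderiv ℝ (inChart d η.1) (fun _ => chartOne d G) ![v, w]) 0 := by
    intro b b' v w hb hb'
    have hw : HasDerivAt (fun t => (![extChartAt (𝓡 d) (1 : G) (b t),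
        extChartAt (𝓡 d) (1 : G) (b' t)] : Fin 2 → EuclideanSpace ℝ (Fin d))) ![v, w] 0 := by
      rw [hasDerivAt_pi]
      intro i
      fin_cases i
      · exact hb.hasDerivAt_extChartAt
      · exact hb'.hasDerivAt_extChartAt
    have h0 : (![extChartAt (𝓡 d) (1 : G) (b 0), extChartAt (𝓡 d) (1 : G) (b' 0)] :
        Fin 2 → EuclideanSpace ℝ (Fin d)) = fun _ => chartOne d G := by
      rw [hb.1, hb'.1]
      ext1 i
      fin_cases i <;> rfl
    have hd : DifferentiableAt ℝ (inChart d η.1) (![extChartAt (𝓡 d) (1 : G) (b 0),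
        extChartAt (𝓡 d) (1 : G) (b' 0)] : Fin 2 → EuclideanSpace ℝ (Fin d)) := by
      rw [h0]
      exact (contDiffAt_inChart η.2.1).differentiableAt (by simp)
    have h := hd.hasFDerivAt.comp_hasDerivAt (0 : ℝ) hw
    rw [h0] at h
    refine h.congr_of_eventuallyEq ?_
    filter_upwards [hb.tendsto.eventually (eventually_extChartAt_symm_apply (d := d)),
      hb'.tendsto.eventually (eventually_extChartAt_symm_apply (d := d))] with t ht ht'
    refine congrArg η.1 (funext fun i => ?_)
    fin_cases i
    · exact ht.symm
    · exact ht'.symm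
  -- Normalization enters here: `η` vanishes along the curves `(c, 1)` and `(1, c')`, so its
  -- differential is zero on each axis, and by linearity on their sum.
  have hx : fderiv ℝ (inChart d η.1) (fun _ => chartOne d G) ![x, 0] = 0 := by
    refine (key hc hasVelocity_const).unique ?_
    simp only [fun t => η.2.2 ![c t, 1] ⟨1, rfl⟩]
    exact hasDerivAt_const _ _
  have hy : fderiv ℝ (inChart d η.1) (fun _ => chartOne d G) ![0, y] = 0 := by
    refine (key hasVelocity_const hc').unique ?_
    simp only [fun t => η.2.2 ![1, c' t] ⟨0, rfl⟩]
    exact hasDerivAt_const _ _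
  have hxy : (![x, y] : Fin 2 → EuclideanSpace ℝ (Fin d)) = ![x, 0] + ![0, y] := by simp
  have h := key hc hc'
  rwa [hxy, map_add, hx, hy, add_zero] at h

end GraphRestriction

/-! ### The van Est map and its compatibility with both operators -/

section VanEstMap
variable {d : ℕ} {G : Type*} [TopologicalSpace G] [ChartedSpace (EuclideanSpace ℝ (Fin d)) G]
  [Group G] [LieGroup (𝓡 d) ∞ G] [T2Space G] {V : Type*} [NormedAddCommGroup V] [NormedSpace ℝ V]

/-- The van Est map on normalized smooth cochains. -/
def vanEst (n : ℕ) : GroupCochain d G V n →ₗ[ℝ] LieCochain d G V n where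
  toFun α := (expJetMultilinear α.1).alternatization
  map_add' α β := by
    ext x
    simp only [MultilinearMap.alternatization_apply, MultilinearMap.domDomCongr_apply,
      AlternatingMap.add_apply, expJetMultilinear_apply α.2.1, expJetMultilinear_apply β.2.1,
      expJetMultilinear_apply (α + β).2.1, ← Finset.sum_add_distrib, ← smul_add]
    refine Finset.sum_congr rfl fun σ _ => ?_
    rw [← expJet_add α.2.1 β.2.1]
    rfl
  map_smul' a α := by
    ext x
    simp only [MultilinearMap.alternatization_apply, MultilinearMap.domDomCongr_apply,
      AlternatingMap.smul_apply, expJetMultilinear_apply α.2.1,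
      expJetMultilinear_apply (a • α).2.1, Finset.smul_sum, RingHom.id_apply]
    refine Finset.sum_congr rfl fun σ _ => ?_
    rw [smul_comm a, ← expJet_smul a α.2.1]
    rfl

lemma vanEst_apply {n : ℕ} (α : GroupCochain d G V n) (x : Fin n → GroupLieAlgebra (𝓡 d) G) :
    vanEst n α x = altSum (expJet α.1) x := by
  change (expJetMultilinear α.1).alternatization x = _
  simp only [MultilinearMap.alternatization_apply, MultilinearMap.domDomCongr_apply,
    expJetMultilinear_apply α.2.1]
  rfl

lemma expJet_groupCobFun (Θ : SmoothRep d G V) {n : ℕ} {α : (Fin n → G) → V}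
    (hα : ContMDiff (powModel (𝓡 d) n) 𝓘(ℝ, V) ∞ α) (u : Fin (n + 1) → GroupLieAlgebra (𝓡 d) G) :
    expJet (groupCobFun Θ α) u = Θ.lie (u 0) (expJet α fun i => u i.succ) +
      ∑ k : Fin n, (-1 : ℝ) ^ (k.val + 1) • expJet (fun g : Fin (n + 1) → G =>
        α (Fin.contractNth k.castSucc (· * ·) g)) u := by
  have h1 : ContMDiff (powModel (𝓡 d) (n + 1)) 𝓘(ℝ, V) ∞ fun g : Fin (n + 1) → G =>
      Θ (g 0) (α fun i => g i.succ) :=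
    (Θ.smooth.comp (contMDiff_power_apply _ 0)).clm_apply
      (hα.comp (contMDiff_power _ _ fun i => contMDiff_power_apply _ _))
  have h2 : ∀ k : Fin n, ContMDiff (powModel (𝓡 d) (n + 1)) 𝓘(ℝ, V) ∞ fun g : Fin (n + 1) → G =>
      α (Fin.contractNth k.castSucc (· * ·) g) := fun k => hα.comp (contMDiff_contractNth _)
  have h3 : ContMDiff (powModel (𝓡 d) (n + 1)) 𝓘(ℝ, V) ∞ fun g : Fin (n + 1) → G =>
      α fun i => g i.castSucc := hα.comp (contMDiff_power _ _ fun i => contMDiff_power_apply _ _)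
  have h2' := fun k : Fin n => contMDiff_constSmul ((-1 : ℝ) ^ (k.val + 1)) (h2 k)
  have h2'' : ContMDiff (powModel (𝓡 d) (n + 1)) 𝓘(ℝ, V) ∞ fun g : Fin (n + 1) → G =>
      ∑ k : Fin n, (-1 : ℝ) ^ (k.val + 1) • α (Fin.contractNth k.castSucc (· * ·) g) :=
    contMDiff_finsetSum fun k _ => h2' k
  have e1 := expJet_add (h1.add h2'') (contMDiff_constSmul ((-1 : ℝ) ^ (n + 1)) h3) u
  have e2 := expJet_add h1 h2'' u
  rw [expJet_smul _ h3, expJet_castSucc, smul_zero, add_zero] at e1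
  rw [expJet_rep Θ hα, expJet_sum _ h2'] at e2
  simp only [fun k => expJet_smul ((-1 : ℝ) ^ ((k : Fin n).val + 1)) (h2 k)] at e2
  exact e1.trans e2

/-- The van Est map is a cochain map. -/
lemma vanEst_groupCob (Θ : SmoothRep d G V) (m : ℕ) (α : GroupCochain d G V (m + 1)) :
    vanEst (m + 2) (groupCob Θ (m + 1) α) = ceCob Θ.lie m (vanEst (m + 1) α) := by
  ext x
  rw [vanEst_apply, ceCob_apply, ceCobFun_eq_altSum _ _ _ (vanEst_apply α)]
  have e : expJet (groupCob Θ (m + 1) α).1 = fun u : Fin (m + 2) → GroupLieAlgebra (𝓡 d) G =>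
      Θ.lie (u 0) (expJet α.1 fun i => u i.succ) + ∑ k : Fin (m + 1), (-1 : ℝ) ^ (k.val + 1) •
        expJet (fun g : Fin (m + 2) → G => α.1 (Fin.contractNth k.castSucc (· * ·) g)) u :=
    funext fun u => expJet_groupCobFun Θ α.2.1 u
  rw [e, altSum_add, altSum_sum, sub_eq_add_neg]
  congr 1
  rw [Finset.smul_sum, ← Finset.sum_neg_distrib]
  refine Finset.sum_congr rfl fun k _ => ?_
  have h := altSum_map (DistribSMul.toAddMonoidHom V ((-1 : ℝ) ^ (k.val + 1))) (expJet
    (fun g : Fin (m + 2) → G => α.1 (Fin.contractNth k.castSucc (· * ·) g))) x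
  refine h.trans ?_
  -- The swap defect of the `k`-th contraction is the bracket insertion, so the two sums agree term
  -- by term. The minus sign is that of `(-1)^(k+1)`.
  rw [altSum_eq_half_smul (i := k.castSucc) (j := k.succ) (by simp [Fin.ext_iff])
    (expJet_contractNth_sub_swap α.2.1 k), DistribSMul.toAddMonoidHom_apply,
    smul_comm, ← smul_neg]
  congr 1
  rcases Nat.even_or_odd k.val with hk | hk <;> simp [pow_succ, hk.neg_one_pow]

lemma derivOne_eq_of_hasDerivAt {f : G → V} (hf : MDifferentiableAt (𝓡 d) 𝓘(ℝ, V) f 1)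
    {x : GroupLieAlgebra (𝓡 d) G} {v : V} (h : HasDerivAt (fun t : ℝ => f (lieExp (t • x))) v 0) :
    derivOne 𝓘(ℝ, V) f (x : EuclideanSpace ℝ (Fin d)) = v :=
  ((hasVelocity_lieExp x).hasDerivAt hf).unique h

/-- `D(exp(tx)) exp(tx)` has velocity `Dx + x`, on which the derivative of `Θ` is additive. -/
lemma SmoothRep.lie_twist (Θ : SmoothRep d G V) (D : DifferenceOperator d G) :
    (Θ.twist D).lie = lieTwist Θ.lie D.lie := by
  refine LinearMap.ext fun x => ?_
  have h := ((D.hasVelocity (hasVelocity_lieExp x)).mul (hasVelocity_lieExp x)).hasDerivAt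
    (f := fun g => Θ g) (Θ.smooth.mdifferentiableAt (by simp))
  have e := derivOne_eq_of_hasDerivAt (f := fun g => Θ.twist D g)
    ((Θ.twist D).smooth.mdifferentiableAt (by simp)) h
  have e' := e.trans ((derivOne 𝓘(ℝ, V →L[ℝ] V) fun g => Θ g).map_add
    (D.lie x : EuclideanSpace ℝ (Fin d)) (x : EuclideanSpace ℝ (Fin d)))
  rw [add_comm] at e'
  exact congrArg (ContinuousLinearMap.coeLM ℝ) e'

lemma expJet_one (α : (Fin 1 → G) → V) (u : Fin 1 → GroupLieAlgebra (𝓡 d) G) :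
    expJet α u = deriv (fun t : ℝ => α fun _ => lieExp (t • u 0)) 0 := by
  rw [expJet_succ]
  congr 1
  ext t
  refine congrArg α (funext fun i : Fin 1 => ?_)
  rw [Subsingleton.elim i 0]
  rfl

variable {D : DifferenceOperator d G}

lemma expJet_restrictGraph (D : DifferenceOperator d G) (η : GroupCochain d G V 2)
    (u : Fin 1 → GroupLieAlgebra (𝓡 d) G) : expJet (restrictGraph D η).1 u = 0 := by
  rw [expJet_one]
  exact (hasDerivAt_normalized_two η (D.hasVelocity (hasVelocity_lieExp (u 0)))
    (hasVelocity_lieExp (u 0))).deriv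

lemma vanEst_restrictGraph (D : DifferenceOperator d G) (η : GroupCochain d G V 2) :
    vanEst 1 (restrictGraph D η) = 0 := by
  ext x
  rw [vanEst_apply, altSum]
  simp [expJet_restrictGraph]

/-- In degrees one and two `p(α)` comes from graph restrictions, which the van Est map kills; in
degree two it must also commute with the `Θ_D`-coboundary. -/
lemma altSum_expJet_pKFun (ρ : DifferenceRep V D) {n : ℕ} (hn : 1 ≤ n) (α : GroupCochain d G V n)
    (x : Fin n → GroupLieAlgebra (𝓡 d) G) : altSum (expJet (pKFun ρ n α.1)) x = 0 := by
  match n, hn with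
  | 1, _ => rw [pKFun_one, ← vanEst_apply, map_neg, vanEst_restrictGraph, neg_zero]; rfl
  | 2, _ =>
    rw [pKFun_two, ← vanEst_apply, vanEst_groupCob, vanEst_restrictGraph, map_zero]
    rfl
  | n + 3, _ =>
    have : expJet (pKFun ρ (n + 3) α.1) = fun _ : Fin (n + 3) → GroupLieAlgebra (𝓡 d) G => (0 : V) :=
      funext fun u => expJet_zero u
    rw [this]
    simp [altSum]

variable [FiniteDimensional ℝ V]

/-- The curves `D(exp(tuᵢ)) exp(tuᵢ)` may be replaced by one-parameter subgroups of the same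
velocity `D(uᵢ) + uᵢ`. -/
lemma expJet_hKFun (ρ : DifferenceRep V D) {n : ℕ} {α : (Fin n → G) → V}
    (hα : ContMDiff (powModel (𝓡 d) n) 𝓘(ℝ, V) ∞ α) (u : Fin n → GroupLieAlgebra (𝓡 d) G) :
    expJet (hKFun ρ n α) u =
      (-1 : ℝ) ^ n • (expJet α (fun i => D.lie (u i) + u i) - expJet α u - ρ.T (expJet α u)) := by
  have h1 : ContMDiff (powModel (𝓡 d) n) 𝓘(ℝ, V) ∞ fun g : Fin n → G => α fun i => D (g i) * g i :=
    hα.comp (contMDiff_power _ _ fun i =>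
      (D.smooth.comp (contMDiff_power_apply _ i)).mul (contMDiff_power_apply _ i))
  have h2 : ContMDiff (powModel (𝓡 d) n) 𝓘(ℝ, V) ∞ fun g : Fin n → G => ρ.T (α g) :=
    (LinearMap.toContinuousLinearMap ρ.T).contMDiff.comp hα
  have e1 := expJet_smul ((-1 : ℝ) ^ n) ((h1.sub h2).sub hα) u
  have e2 := expJet_sub (h1.sub h2) hα u
  have e3 := expJet_sub h1 h2 u
  have e4 : expJet (fun g : Fin n → G => α fun i => D (g i) * g i) u =
      expJet α fun i => D.lie (u i) + u i :=
    mixedDeriv_eq_expJet hα fun i =>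
      (D.hasVelocity (hasVelocity_lieExp (u i))).mul (hasVelocity_lieExp (u i))
  have e5 := expJet_clm (LinearMap.toContinuousLinearMap ρ.T) hα u
  refine e1.trans (congrArg _ (e2.trans ?_))
  rw [sub_right_comm, ← e4]
  exact congrArg (· - expJet α u) (e3.trans (congrArg _ e5))

lemma vanEst_groupK (ρ : DifferenceRep V D) {n : ℕ} (hn : 1 ≤ n) (α : GroupCochain d G V n) :
    vanEst n (groupK ρ n α) = lieK D.lie ρ.T n (vanEst n α) := by
  ext x
  have hp := pKFun_mem ρ n α.2
  have hh := hKFun_mem ρ n α.2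
  have e : expJet (groupK ρ n α).1 = fun u : Fin n → GroupLieAlgebra (𝓡 d) G =>
      expJet (pKFun ρ n α.1) u + expJet (hKFun ρ n α.1) u :=
    funext fun u => expJet_add hp.1 hh.1 u
  rw [vanEst_apply, e, altSum_add, altSum_expJet_pKFun ρ hn, zero_add, lieK_apply]
  simp only [vanEst_apply]
  simp only [altSum, expJet_hKFun ρ α.2.1, map_sum, map_zsmul, ← Finset.sum_sub_distrib,
    ← smul_sub, Finset.smul_sum]
  exact Finset.sum_congr rfl fun σ _ => smul_comm _ _ _

end VanEstMap

end
end DiffLie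

theorem mainTheorem3 {d : ℕ} {G : Type*} [TopologicalSpace G] [T2Space G]
    [ChartedSpace (EuclideanSpace ℝ (Fin d)) G] [Group G] [LieGroup (𝓡 d) ∞ G]
    {V : Type*} [NormedAddCommGroup V] [NormedSpace ℝ V] [FiniteDimensional ℝ V]
    (D : DifferenceOperator d G) (ρ : DifferenceRep V D) :
    ∃ VE : ∀ n, GroupCochain d G V n →ₗ[ℝ] LieCochain d G V n,
      (∀ n (α : GroupCochain d G V n) (x : Fin n → GroupLieAlgebra (𝓡 d) G),
        VE n α x = vanEstFun α.1 x) ∧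
      (∀ n, 1 ≤ n → VE n ∘ₗ groupK ρ n = lieK D.lie ρ.T n ∘ₗ VE n) ∧
      (∀ k, totalMap VE (k + 1) ∘ₗ groupDelta ρ k = lieDelta ρ k ∘ₗ totalMap VE k) ∧
      ∀ k, ∃ φ : Cohomology (groupDelta ρ) k →ₗ[ℝ] Cohomology (lieDelta ρ) k,
        ∀ z : LinearMap.ker (groupDelta ρ k), ∃ w : LinearMap.ker (lieDelta ρ k),
          w.1 = totalMap VE k z.1 ∧
            φ (cohClass (groupDelta ρ) k z) = cohClass (lieDelta ρ) k w := by
  have hK : ∀ n, 1 ≤ n → vanEst n ∘ₗ groupK ρ n = lieK D.lie ρ.T n ∘ₗ vanEst n :=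
    fun n hn => LinearMap.ext fun α => vanEst_groupK ρ hn α
  have hδ : ∀ k, totalMap vanEst (k + 1) ∘ₗ groupDelta ρ k =
      lieDelta ρ k ∘ₗ totalMap vanEst k :=
    totalMap_comp_totalCob (C := fun n => GroupCochain d G V n) (C' := LieCochain d G V) vanEst
      _ _ _ _ _ _ (fun k => LinearMap.ext fun α => vanEst_groupCob ρ.Θ k α)
      (fun k => LinearMap.ext fun α => by
        have h := vanEst_groupCob (ρ.Θ.twist D) k α
        -- The cochain property for `Θ_D` lands in the complex of its derivative, which has to be
        -- recognized as `θ_D`.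
        rw [SmoothRep.lie_twist] at h
        exact h) hK
  exact ⟨vanEst, fun n α x => (vanEst_apply α x).trans (vanEstFun_eq_altSum α.1 x).symm, hK, hδ,
    exists_cohomology_map (groupDelta ρ) (lieDelta ρ) (fun k => totalMap
      (C := fun n => GroupCochain d G V n) (C' := LieCochain d G V) vanEst k) hδ⟩
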